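/- Let $n\ge 2$ and let $T$ be a rooted binary tree with $n$ leaves in which every non-leaf node has exactly two (ordered) children. The leaves are labelled $1,\dots,n$ from left to right, and each non-leaf node $v$ is labelled with a number $q_v\in[\tfrac12,1]$. For leaves $i\ne j$ let $i\vee j$ be their lowest common ancestor. Suppose that ${\bf P}=(p_{i,j})_{i\ne j}$ has league structure $T$, i.e. $p_{i,j}=q_{i\vee j}$ and $p_{j,i}=1-p_{i,j}$ for all $i<j$. The chain $\mathcal M_{tree}(T)$ on the permutations $\sigma=(\sigma(1),\dots,\sigma(n))$ of $\{1,\dots,n\}$ makes the following step. Choose a pair $a<b$ uniformly at random among the $\binom n2$ pairs. If no element located strictly between $a$ and $b$ in $\sigma$ is a descendant of $a\vee b$ in $T$, then, leaving all other elements in their positions, place $a$ before $b$ with probability $p_{a,b}$ and $b$ before $a$ with probability $1-p_{a,b}$. Otherwise do nothing. Its stationary distribution is $\pi(\sigma)=\frac1Z\prod_{i<j}p_{\sigma(i),\sigma(j)}$, where $Z$ is the normalizing constant. With $P$ the transition matrix, let $$\tau_{tree}(\epsilon)=\min\Big\{t:\ \max_{x}\tfrac12\sum_{y}|P^{t'}(x,y)-\pi(y)|\le\epsilon\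 \text{ for all } t'\ge t\Big\}$$ be the mixing time. Then: 1. There is an absolute constant $C>0$ such that, for all $n\ge2$, all $T$ and ${\bf P}$ as above and all $0<\epsilon\le1$, the distribution $\pi$ is stationary, $\tau_{tree}(\epsilon)$ exists (is finite), and $$\tau_{tree}(\epsilon)\le C\,n^5\log(n/\epsilon).$$ 2. For every $q_0>\tfrac12$ there is a constant $C>0$, depending only on $q_0$, such that, for all $n\ge2$, all $T$ and ${\bf P}$ as above for which every non-leaf label satisfies $q_v\ge q_0$, and all $0<\epsilon\le1$, $$\tau_{tree}(\epsilon)\le C\,n^3\log n\,\log(n/\epsilon).$$ -/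

import Mathlib

namespace LeagueHierarchy

/-!
A proper rooted binary tree whose non-leaf nodes carry labels is a `BinaryTree α`: the constructor
`nil` is a leaf and `node q l r` is a non-leaf node with label `q`. A node is addressed by the
path leading to it from the root (`false` = go left, `true` = go right). The leaves are numbered
`0, 1, 2, …` from left to right.
-/

/-- The address of the `i`-th leaf (from the left, starting with `0`), for `i < T.numLeaves`. -/
def leafAddress {α : Type*} : BinaryTree α → ℕ → List Bool
  | .nil, _ => []
  | .node _ l r, i =>
      if i < l.numLeaves then false :: leafAddress l i
      else true :: leafAddress r (i - l.numLeaves)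

/-- The label of the non-leaf node with the given address;
`none` if there is no non-leaf node at this address. -/
def labelAt {α : Type*} : BinaryTree α → List Bool → Option α
  | .nil, _ => none
  | .node q _ _, [] => some q
  | .node _ l _, false :: v => labelAt l v
  | .node _ _ r, true :: v => labelAt r v

/-- The longest common prefix of two addresses. -/
def commonPrefix : List Bool → List Bool → List Bool
  | x :: xs, y :: ys => if x = y then x :: commonPrefix xs ys else []
  | _, _ => []

/-- The (address of the) lowest common ancestor of the leaves `i` and `j`. -/
def lca {α : Type*} (T : BinaryTree α) (i j : ℕ) : List Bool :=
  commonPrefix (leafAddress T i) (leafAddress T j)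

/-- The leaf `c` is a descendant of the node with address `v`. -/
def IsDescendant {α : Type*} (T : BinaryTree α) (c : ℕ) (v : List Bool) : Prop :=
  v <+: leafAddress T c

/-- `T` is a proper rooted binary tree with `n` leaves whose non-leaf nodes have labels
in `[1/2, 1]`. -/
def IsLeagueTree (n : ℕ) (T : BinaryTree ℝ) : Prop :=
  T.numLeaves = n ∧ ∀ (v : List Bool) (q : ℝ), labelAt T v = some q → 1 / 2 ≤ q ∧ q ≤ 1

/-- For all `i < j`, `p i j` is the label of the lowest common ancestor of the leaves `i` and `j`,
and `p j i = 1 - p i j`. -/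
def HasLeagueStructure {n : ℕ} (p : Fin n → Fin n → ℝ) (T : BinaryTree ℝ) : Prop :=
  ∀ i j : Fin n, i < j → labelAt T (lca T i j) = some (p i j) ∧ p j i = 1 - p i j

/-!
A permutation `σ : Equiv.Perm (Fin n)` is the list `σ 0, σ 1, …, σ (n - 1)` of elements, so that
`σ.symm a` is the position of the element `a`, and `Equiv.swap a b * σ` is `σ` with the
elements `a` and `b` interchanged.
-/

/-- No element strictly between `a` and `b` in `σ` is a descendant of the lowest common
ancestor of `a` and `b`. -/
def Movable {n : ℕ} (T : BinaryTree ℝ) (σ : Equiv.Perm (Fin n)) (a b : Fin n) : Prop :=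
  ∀ c : Fin n,
    (σ.symm a < σ.symm c ∧ σ.symm c < σ.symm b) ∨ (σ.symm b < σ.symm c ∧ σ.symm c < σ.symm a) →
      ¬ IsDescendant T c (lca T a b)

/-- `σ` rearranged so that `a` precedes `b`, all other elements staying in place. -/
def place {n : ℕ} (σ : Equiv.Perm (Fin n)) (a b : Fin n) : Equiv.Perm (Fin n) :=
  if σ.symm a < σ.symm b then σ else Equiv.swap a b * σ

open scoped Classical in
/-- The transition matrix of the chain: a pair `a < b` is chosen uniformly at random among
the `n.choose 2` pairs. If it is movable, then `a` is put before `b` with probability `p a b` and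
`b` before `a` with probability `1 - p a b`. Otherwise nothing changes. -/
noncomputable def treeChain {n : ℕ} (T : BinaryTree ℝ) (p : Fin n → Fin n → ℝ) :
    Matrix (Equiv.Perm (Fin n)) (Equiv.Perm (Fin n)) ℝ :=
  fun σ τ => ∑ a : Fin n, ∑ b ∈ Finset.Ioi a, (1 / (n.choose 2 : ℝ)) *
    (if Movable T σ a b then
      p a b * (if τ = place σ a b then 1 else 0) + (1 - p a b) * (if τ = place σ b a then 1 else 0)
    else if τ = σ then 1 else 0)

/-- The unnormalized weight `∏_{i < j} p (σ i) (σ j)`. -/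
noncomputable def weight {n : ℕ} (p : Fin n → Fin n → ℝ) (σ : Equiv.Perm (Fin n)) : ℝ :=
  ∏ i : Fin n, ∏ j ∈ Finset.Ioi i, p (σ i) (σ j)

/-- The distribution `π(σ) = ∏_{i < j} p (σ i) (σ j) / Z`. -/
noncomputable def permDist {n : ℕ} (p : Fin n → Fin n → ℝ) (σ : Equiv.Perm (Fin n)) : ℝ :=
  weight p σ / ∑ τ : Equiv.Perm (Fin n), weight p τ

/-- `π` is a probability distribution on `Ω` that is stationary for the transition matrix `M`. -/
def IsStationary {Ω : Type*} [Fintype Ω] (M : Matrix Ω Ω ℝ) (π : Ω → ℝ) : Prop :=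
  π ∈ stdSimplex ℝ Ω ∧ Matrix.vecMul π M = π

/-- The total variation distance to `π` of the chain after `t` steps,
maximized over the starting state. -/
noncomputable def tvDist {Ω : Type*} [Fintype Ω] [DecidableEq Ω] (M : Matrix Ω Ω ℝ) (π : Ω → ℝ)
    (t : ℕ) : ℝ :=
  ⨆ x : Ω, (1 / 2 : ℝ) * ∑ y : Ω, |(M ^ t) x y - π y|

/-- `τ` is the mixing time `τ(ε)` of the chain `M` with stationary distribution `π`: the least `t`
such that the total variation distance is at most `ε` at all times `t' ≥ t`. -/
def IsMixingTime {Ω : Type*} [Fintype Ω] [DecidableEq Ω] (M : Matrix Ω Ω ℝ) (π : Ω → ℝ)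
    (ε : ℝ) (τ : ℕ) : Prop :=
  IsStationary M π ∧ IsLeast {t : ℕ | ∀ t' : ℕ, t ≤ t' → tvDist M π t' ≤ ε} τ

end LeagueHierarchy

/-! The proof is path coupling in dual form: instead of coupling two copies of the chain, it shows
that the transition operator contracts a weighted Lipschitz constant of functions on permutations.

Read the descendants of a node `v`, in their order in `σ`, as a word in the letters L and R (left or
right subtree of `v`). A step at `v` exchanges two neighbouring unequal letters; steps at other
nodes leave this word alone. An `IsEdge` joins two states differing by one such exchange. Its length
is γ^r γ^(-h) (j+1)(m-1-j), where h and r count the L's and R's before the exchanged letters, j = h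
+ r, and m is the length of the word.

For most choices of a pair, both endpoints of an edge move in parallel. Choosing the edge's own pair
merges them. Harm comes only from the letter just before or just after the exchanged ones, through
at most one pair for each. The exponential factor is tuned so that in every such case the
probability of the harmful move, times the ratio of exponential factors, is at most κ. With P =
(j+1)(m-1-j), the harm is then proportional to κ(j(m-j) + (j+2)(m-2-j)) = κ(2P-2), against a gain P.
For κ = 1/2 strict concavity leaves the relative surplus ρ = 4/n²; labels bounded away from 1/2
allow κ < 1/2 and a constant ρ. Hence one step contracts by 1 - ρ/(n choose 2)
(`IsLip.treeChain_mulVec`).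

Any two permutations are joined by fewer than n! edges of lengths between 3^(-n) and 3^n n². The
logarithm of this distortion is O(n log n), which yields a mixing time of order (n³/ρ) log(n/ε)
(`tvDist_treeChain_le`, `exists_isMixingTime`). Stationarity follows from detailed balance
(`mul_weight_eq`, `sum_weight_mul_heat`). -/

namespace LeagueHierarchy

open Equiv

/-! ### Leaf addresses and lowest common ancestors. -/

section Tree

theorem commonPrefix_append (v x y : List Bool) :
    commonPrefix (v ++ false :: x) (v ++ true :: y) = v := by
  induction v with
  | nil => simp [commonPrefix]
  | cons h t ih => simp [commonPrefix, ih]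

theorem commonPrefix_comm (x y : List Bool) : commonPrefix x y = commonPrefix y x := by
  induction x generalizing y with
  | nil => cases y <;> simp [commonPrefix]
  | cons h t ih =>
    cases y with
    | nil => simp [commonPrefix]
    | cons h' t' =>
      by_cases hh : h = h'
      · subst hh; simp [commonPrefix, ih t']
      · simp [commonPrefix, hh, Ne.symm hh]

/-- The leaf `c` lies below the left child of the node `v`. -/
def InLeft {α : Type*} (T : BinaryTree α) (v : List Bool) (c : ℕ) : Prop :=
  (v ++ [false]) <+: leafAddress T c

/-- The leaf `c` lies below the right child of the node `v`. -/
def InRight {α : Type*} (T : BinaryTree α) (v : List Bool) (c : ℕ) : Prop :=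
  (v ++ [true]) <+: leafAddress T c

variable {α : Type*} {T : BinaryTree α} {u v : List Bool} {a b c d : ℕ}

theorem InLeft.isDescendant (h : InLeft T v c) : IsDescendant T c v :=
  (List.prefix_append v [false]).trans h

theorem InRight.isDescendant (h : InRight T v c) : IsDescendant T c v :=
  (List.prefix_append v [true]).trans h

theorem eq_of_append_singleton_prefix {x y : Bool} {l : List Bool} (h : (v ++ [x]) <+: l)
    (h' : (v ++ [y]) <+: l) : x = y := by
  obtain ⟨s, rfl⟩ := h
  obtain ⟨t, ht⟩ := h'
  simp at ht
  exact ht.1.symm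

theorem InLeft.not_inRight (h : InLeft T v c) : ¬ InRight T v c := fun h' => by
  simpa using eq_of_append_singleton_prefix h h'

theorem exists_inLeft_inRight (T : BinaryTree α) {i j : ℕ} (hij : i < j) (hj : j < T.numLeaves) :
    ∃ v, InLeft T v i ∧ InRight T v j := by
  induction T generalizing i j with
  | nil => simp [BinaryTree.numLeaves] at hj; omega
  | node q l r ihl ihr =>
    simp only [BinaryTree.numLeaves] at hj
    by_cases h1 : j < l.numLeaves
    · obtain ⟨v, hv, hv'⟩ := ihl hij h1
      have h2 : i < l.numLeaves := by omega
      exact ⟨false :: v, by simpa [InLeft, leafAddress, h2] using hv,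
        by simpa [InRight, leafAddress, h1] using hv'⟩
    · by_cases h2 : i < l.numLeaves
      · exact ⟨[], by simp [InLeft, leafAddress, h2], by simp [InRight, leafAddress, h1]⟩
      · obtain ⟨v, hv, hv'⟩ := ihr (i := i - l.numLeaves) (j := j - l.numLeaves)
          (by omega) (by omega)
        exact ⟨true :: v, by simpa [InLeft, leafAddress, h2] using hv,
          by simpa [InRight, leafAddress, h1] using hv'⟩

theorem lca_comm (T : BinaryTree α) (i j : ℕ) : lca T i j = lca T j i :=
  commonPrefix_comm _ _

theorem lca_eq (hc : InLeft T v c) (hd : InRight T v d) : lca T c d = v := by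
  obtain ⟨s, hs⟩ := hc
  obtain ⟨t, ht⟩ := hd
  rw [lca, ← hs, ← ht]
  simpa using commonPrefix_append v s t

theorem inLeft_lca (hab : a < b) (hb : b < T.numLeaves) : InLeft T (lca T a b) a := by
  obtain ⟨v, h, h'⟩ := exists_inLeft_inRight T hab hb
  rwa [lca_eq h h']

theorem inRight_lca (hab : a < b) (hb : b < T.numLeaves) : InRight T (lca T a b) b := by
  obtain ⟨v, h, h'⟩ := exists_inLeft_inRight T hab hb
  rwa [lca_eq h h']

theorem lt_of_inLeft_inRight (hc : InLeft T v c) (hd : InRight T v d) (hcT : c < T.numLeaves) :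
    c < d := by
  rcases lt_trichotomy c d with h | h | h
  · exact h
  · subst h; exact absurd hd hc.not_inRight
  · have h1 := inLeft_lca h hcT
    rw [lca_comm, lca_eq hc hd] at h1
    exact absurd hd h1.not_inRight

theorem eq_or_append_prefix (h : u <+: v) : u = v ∨ ∃ x, (u ++ [x]) <+: v := by
  obtain ⟨s, hs⟩ := h
  cases s with
  | nil => left; simpa using hs
  | cons x s => exact Or.inr ⟨x, s, by simpa using hs⟩

end Tree

/-! ### Relative order of elements under transpositions and relabellings. -/

section Order

variable {n : ℕ} {S : Fin n → Prop} {σ : Perm (Fin n)} {a b c d x y : Fin n}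

/-- No element strictly between `a` and `b` in `σ` belongs to `S`. -/
def Clear (S : Fin n → Prop) (σ : Perm (Fin n)) (a b : Fin n) : Prop :=
  ∀ c : Fin n,
    (σ.symm a < σ.symm c ∧ σ.symm c < σ.symm b) ∨ (σ.symm b < σ.symm c ∧ σ.symm c < σ.symm a) →
      ¬ S c

theorem swap_mul_symm_apply (σ : Perm (Fin n)) (a b x : Fin n) :
    (swap a b * σ).symm x = σ.symm (swap a b x) := by
  rw [Equiv.symm_apply_eq]; simp

theorem swap_swap_mul (σ : Perm (Fin n)) (a b : Fin n) : swap a b * (swap a b * σ) = σ := by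
  simp [← mul_assoc]

theorem Clear.symm (h : Clear S σ a b) : Clear S σ b a := fun c hc => h c hc.symm

/-- With no member of `S` between them, `c` and `d` trade places without passing a third member.
This locality is behind every comparison of a step with its effect at another node. -/
theorem Clear.swap_symm_lt_iff (h : Clear S σ c d) (hx : S x) (hy : S y)
    (h1 : ¬ (x = c ∧ y = d)) (h2 : ¬ (x = d ∧ y = c)) :
    (swap c d * σ).symm x < (swap c d * σ).symm y ↔ σ.symm x < σ.symm y := by
  simp only [swap_mul_symm_apply]
  have inj : ∀ {u w : Fin n}, u ≠ w → σ.symm u ≠ σ.symm w := fun h => by simpa using h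
  by_cases xc : x = c
  · subst xc
    by_cases yx : y = x
    · simp [yx]
    have yd : y ≠ d := fun e => h1 ⟨rfl, e⟩
    rw [swap_apply_left, swap_apply_of_ne_of_ne yx yd]
    have := h y; have := inj yx; have := inj yd
    grind
  by_cases xd : x = d
  · subst xd
    by_cases yx : y = x
    · simp [yx]
    have yd : y ≠ c := fun e => h2 ⟨rfl, e⟩
    rw [swap_apply_right, swap_apply_of_ne_of_ne yd yx]
    have := h y; have := inj yx; have := inj yd
    grind
  rw [swap_apply_of_ne_of_ne xc xd]
  have := inj xc; have := inj xd; have := h x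
  by_cases yc : y = c
  · subst yc
    rw [swap_apply_left]
    grind
  by_cases yd : y = d
  · subst yd
    rw [swap_apply_right]
    grind
  rw [swap_apply_of_ne_of_ne yc yd]

theorem clear_swap_mul : Clear S (swap c d * σ) c d ↔ Clear S σ c d := by
  simp only [Clear, swap_mul_symm_apply, swap_apply_left, swap_apply_right]
  refine forall_congr' fun x => ?_
  by_cases xc : x = c
  · subst xc; simp
  by_cases xd : x = d
  · subst xd; simp
  rw [swap_apply_of_ne_of_ne xc xd, or_comm]

theorem Clear.congr_order {σ' : Perm (Fin n)} (h : Clear S σ a b)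
    (h1 : ∀ x, S x → (σ'.symm a < σ'.symm x ↔ σ.symm a < σ.symm x))
    (h2 : ∀ x, S x → (σ'.symm x < σ'.symm b ↔ σ.symm x < σ.symm b))
    (h3 : ∀ x, S x → (σ'.symm b < σ'.symm x ↔ σ.symm b < σ.symm x))
    (h4 : ∀ x, S x → (σ'.symm x < σ'.symm a ↔ σ.symm x < σ.symm a)) : Clear S σ' a b := by
  intro x hx hS
  rw [h1 x hS, h2 x hS, h3 x hS, h4 x hS] at hx
  exact h x hx hS

/-- `t a` stands in `t * σ` exactly where `a` stands in `σ`, so only the labels change. -/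
theorem clear_relabel (t : Perm (Fin n)) (hS : ∀ x, S (t x) ↔ S x) :
    Clear S (t * σ) (t a) (t b) ↔ Clear S σ a b := by
  have key : ∀ x, (t * σ).symm (t x) = σ.symm x := fun x => by
    rw [Equiv.symm_apply_eq]; simp
  unfold Clear
  rw [← t.forall_congr_right]
  simp only [key, hS]

theorem mul_symm_apply_apply (t : Perm (Fin n)) (x : Fin n) : (t * σ).symm (t x) = σ.symm x := by
  rw [Equiv.symm_apply_eq]; simp

open scoped Classical in
/-- The number of elements of `S` that precede `a` in `σ`. -/
noncomputable def numBefore (S : Fin n → Prop) (σ : Perm (Fin n)) (a : Fin n) : ℕ :=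
  (Finset.univ.filter fun c => S c ∧ σ.symm c < σ.symm a).card

theorem numBefore_relabel (t : Perm (Fin n)) (hS : ∀ x, S (t x) ↔ S x) :
    numBefore S (t * σ) (t a) = numBefore S σ a := by
  classical
  unfold numBefore
  symm
  refine Finset.card_equiv t fun x => ?_
  simp [hS, mul_symm_apply_apply]

theorem numBefore_congr {σ' : Perm (Fin n)} {a' : Fin n}
    (h : ∀ x, S x → (σ'.symm x < σ'.symm a' ↔ σ.symm x < σ.symm a)) :
    numBefore S σ' a' = numBefore S σ a := by
  classical
  unfold numBefore
  congr 1
  ext x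
  simp only [Finset.mem_filter, Finset.mem_univ, true_and]
  exact and_congr_right fun hx => h x hx

/-- Passing a single element of `S` increases the count by one. -/
theorem numBefore_succ {σ' : Perm (Fin n)} {a' e : Fin n} (he : S e)
    (hea : ¬ σ.symm e < σ.symm a) (hea' : σ'.symm e < σ'.symm a')
    (h : ∀ x, S x → x ≠ e → (σ'.symm x < σ'.symm a' ↔ σ.symm x < σ.symm a)) :
    numBefore S σ' a' = numBefore S σ a + 1 := by
  classical
  unfold numBefore
  rw [← Finset.card_insert_of_notMem (a := e) (by simp [hea])]
  congr 1
  ext x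
  simp only [Finset.mem_filter, Finset.mem_univ, true_and, Finset.mem_insert]
  by_cases hx : x = e
  · subst hx; simp [he, hea']
  · simp only [hx, false_or]
    exact and_congr_right fun hS => h x hS hx

end Order

/-! ### Subtrees are nested or disjoint. -/

section Laminar

variable {α : Type*} {T : BinaryTree α} {u v : List Bool} {a b c d : ℕ}

theorem laminar (T : BinaryTree α) (u v : List Bool) :
    (∃ x, (u ++ [x]) <+: v) ∨ u = v ∨ (∃ x, (v ++ [x]) <+: u) ∨
      ∀ c, IsDescendant T c u → ¬ IsDescendant T c v := by
  by_cases h : ∃ c, IsDescendant T c u ∧ IsDescendant T c v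
  · obtain ⟨c, hu, hv⟩ := h
    rcases List.prefix_or_prefix_of_prefix hu hv with h | h
    · rcases eq_or_append_prefix h with h | h <;> tauto
    · rcases eq_or_append_prefix h with h | h
      · exact Or.inr (Or.inl h.symm)
      · tauto
  · push Not at h
    tauto

theorem isDescendant_of_prefix (h : u <+: v) (hc : IsDescendant T c v) : IsDescendant T c u :=
  h.trans hc

/-- If `v` lies strictly below `u`, all leaves below `v` are on the same side of `u`. -/
theorem same_side {x : Bool} (h : (u ++ [x]) <+: v) (ha : IsDescendant T a v)
    (hb : IsDescendant T b v) :
    (InLeft T u a ↔ InLeft T u b) ∧ (InRight T u a ↔ InRight T u b) := by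
  have h1 := h.trans ha
  have h2 := h.trans hb
  have key : ∀ {c : ℕ} {y : Bool}, (u ++ [x]) <+: leafAddress T c →
      ((u ++ [y]) <+: leafAddress T c ↔ y = x) := fun hc =>
    ⟨fun h' => eq_of_append_singleton_prefix h' hc, fun e => e ▸ hc⟩
  unfold InLeft InRight
  rw [key h1, key h2, key h1, key h2]
  simp

theorem not_both_of_below {x : Bool} (h : (v ++ [x]) <+: u) (ha : InLeft T v a)
    (hb : InRight T v b) (hau : IsDescendant T a u) : ¬ IsDescendant T b u := fun hbu =>
  ha.not_inRight ((same_side h hau hbu).2.2 hb)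

end Laminar

/-! ### Edges at a node and their invariance under steps elsewhere. -/

section Edges

variable {n : ℕ} {T : BinaryTree ℝ} {u v : List Bool} {σ : Perm (Fin n)} {a b c d : Fin n}

/-- The elements `a` and `b` of `σ`, below the left and the right child of `v`, stand in this order
with no descendant of `v` in between. -/
structure IsEdge (T : BinaryTree ℝ) (v : List Bool) (σ : Perm (Fin n)) (a b : Fin n) : Prop where
  left : InLeft T v a
  right : InRight T v b
  lt : σ.symm a < σ.symm b
  clear : Clear (fun c => IsDescendant T c v) σ a b

/-- The number of leaves below the node `v`. -/
noncomputable def nodeSize (n : ℕ) (T : BinaryTree ℝ) (v : List Bool) : ℕ :=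
  Nat.card {c : Fin n // IsDescendant T c v}

/-- The weight of exchanging neighbours with `h` left and `r` right elements before them. -/
noncomputable def slotWeight (γ : ℝ) (m : ℕ) (h r : ℕ) : ℝ :=
  γ ^ r * γ⁻¹ ^ h * (((h : ℝ) + r + 1) * (m - 1 - (h + r)))

/-- The length assigned to the edge between `σ` and `swap a b * σ`. -/
noncomputable def edgeWeight (T : BinaryTree ℝ) (γ : List Bool → ℝ) (v : List Bool)
    (σ : Perm (Fin n)) (a : Fin n) : ℝ :=
  slotWeight (γ v) (nodeSize n T v) (numBefore (fun c => InLeft T v c) σ a)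
    (numBefore (fun c => InRight T v c) σ a)

theorem IsEdge.of_order {τ : Perm (Fin n)} (he : IsEdge T v σ a b)
    (h : ∀ x y : Fin n, IsDescendant T x v → IsDescendant T y v →
      (τ.symm x < τ.symm y ↔ σ.symm x < σ.symm y)) : IsEdge T v τ a b := by
  have ha := he.left.isDescendant
  have hb := he.right.isDescendant
  refine ⟨he.left, he.right, (h _ _ ha hb).2 he.lt, he.clear.congr_order ?_ ?_ ?_ ?_⟩ <;>
    intro x hx <;> apply h <;> assumption

theorem edgeWeight_of_order (γ : List Bool → ℝ) {τ : Perm (Fin n)}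
    (h : ∀ x : Fin n, IsDescendant T x v →
      (τ.symm x < τ.symm a ↔ σ.symm x < σ.symm a)) :
    edgeWeight T γ v τ a = edgeWeight T γ v σ a := by
  unfold edgeWeight
  rw [numBefore_congr fun x hx => h x (InLeft.isDescendant hx),
    numBefore_congr fun x hx => h x (InRight.isDescendant hx)]

theorem swap_apply_iff {S : Fin n → Prop} (h : S a ↔ S b) (x : Fin n) :
    S (swap a b x) ↔ S x := by
  by_cases xa : x = a
  · subst xa; simpa using h.symm
  by_cases xb : x = b
  · subst xb; simpa using h
  rw [swap_apply_of_ne_of_ne xa xb]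

/-- Exchanging neighbours at a node `u` above `v` keeps the edges at `v`. -/
theorem IsEdge.above {x : Bool} (h : (u ++ [x]) <+: v) (he : IsEdge T v σ a b)
    (hc : InLeft T u c) (hd : InRight T u d)
    (hcd : Clear (fun c => IsDescendant T c u) σ c d) (γ : List Bool → ℝ) :
    IsEdge T v (swap c d * σ) a b ∧
      edgeWeight T γ v (swap c d * σ) a = edgeWeight T γ v σ a := by
  have huv : u <+: v := (List.prefix_append u [x]).trans h
  have key : ∀ y z : Fin n, IsDescendant T y v → IsDescendant T z v →
      ((swap c d * σ).symm y < (swap c d * σ).symm z ↔ σ.symm y < σ.symm z) := by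
    intro y z hy hz
    refine hcd.swap_symm_lt_iff (isDescendant_of_prefix huv hy) (isDescendant_of_prefix huv hz)
      ?_ ?_
    · rintro ⟨rfl, rfl⟩
      exact hc.not_inRight ((same_side h hy hz).2.2 hd)
    · rintro ⟨rfl, rfl⟩
      exact hc.not_inRight ((same_side h hy hz).2.1 hd)
  exact ⟨he.of_order key, edgeWeight_of_order γ
    fun y hy => key _ _ hy he.left.isDescendant⟩

/-- Serves steps at nodes below or unrelated to `v`: these permute elements without changing the L/R
word at `v`, so the edge is carried along with the labels. -/
theorem IsEdge.relabel (he : IsEdge T v σ a b) (t : Perm (Fin n))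
    (hL : ∀ x : Fin n, InLeft T v (t x) ↔ InLeft T v x)
    (hR : ∀ x : Fin n, InRight T v (t x) ↔ InRight T v x)
    (hS : ∀ x : Fin n, IsDescendant T (t x) v ↔ IsDescendant T x v) (γ : List Bool → ℝ) :
    IsEdge T v (t * σ) (t a) (t b) ∧ edgeWeight T γ v (t * σ) (t a) = edgeWeight T γ v σ a := by
  refine ⟨⟨(hL _).2 he.left, (hR _).2 he.right, ?_, ?_⟩, ?_⟩
  · simpa only [mul_symm_apply_apply] using he.lt
  · exact (clear_relabel (S := fun c : Fin n => IsDescendant T c v) t hS).2 he.clear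
  · unfold edgeWeight
    rw [numBefore_relabel (S := fun c : Fin n => InLeft T v c) t hL,
      numBefore_relabel (S := fun c : Fin n => InRight T v c) t hR]

/-- Exchanging neighbours at the same node `v`, but disjoint from `a` and `b`. -/
theorem IsEdge.disjoint (he : IsEdge T v σ a b)
    (hc : InLeft T v c) (hd : InRight T v d) (hca : c ≠ a) (hdb : d ≠ b)
    (hcd : Clear (fun c => IsDescendant T c v) σ c d) (γ : List Bool → ℝ) :
    IsEdge T v (swap c d * σ) a b ∧
      edgeWeight T γ v (swap c d * σ) a = edgeWeight T γ v σ a := by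
  have hda : d ≠ a := by rintro rfl; exact he.left.not_inRight hd
  have hcb : c ≠ b := by rintro rfl; exact hc.not_inRight he.right
  have ha := he.left.isDescendant
  have hb := he.right.isDescendant
  have key : ∀ y z : Fin n, IsDescendant T y v → IsDescendant T z v →
      (y = a ∨ y = b ∨ z = a ∨ z = b) →
      ((swap c d * σ).symm y < (swap c d * σ).symm z ↔ σ.symm y < σ.symm z) := by
    intro y z hy hz h
    refine hcd.swap_symm_lt_iff hy hz ?_ ?_
    · rintro ⟨rfl, rfl⟩; tauto
    · rintro ⟨rfl, rfl⟩; tauto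
  refine ⟨⟨he.left, he.right, (key _ _ ha hb (by simp)).2 he.lt,
    he.clear.congr_order ?_ ?_ ?_ ?_⟩, edgeWeight_of_order γ
    fun y hy => key _ _ hy ha (by simp)⟩ <;>
    intro y hy <;> apply key <;> simp [*]

end Edges

/-! ### One step of the chain for a given pair. -/

section Heat

variable {n : ℕ} {T : BinaryTree ℝ} {p : Fin n → Fin n → ℝ} {σ σ' : Perm (Fin n)}
  {a b c d c' d' : Fin n} {F : Perm (Fin n) → ℝ} {B : ℝ}

open scoped Classical in
/-- The expectation of `F` after the step of the chain that chooses the pair `a`, `b`. -/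
noncomputable def heat (T : BinaryTree ℝ) (p : Fin n → Fin n → ℝ) (F : Perm (Fin n) → ℝ)
    (σ : Perm (Fin n)) (a b : Fin n) : ℝ :=
  if Movable T σ a b then p a b * F (place σ a b) + (1 - p a b) * F (place σ b a) else F σ

/-- The coupling by a common coin: both expectations are the same convex combination of a stationary
and a swapped state, so the bound passes from the two pairs of states to their average. -/
theorem heat_sub_heat_le (hcd : c ≠ d) (hcd' : c' ≠ d') (h0 : 0 ≤ p c d) (h1 : p c d ≤ 1)
    (hp : p c' d' = p c d) (hm : Movable T σ' c' d' ↔ Movable T σ c d)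
    (ho : σ'.symm c' < σ'.symm d' ↔ σ.symm c < σ.symm d)
    (hF : |F σ - F σ'| ≤ B)
    (hF' : Movable T σ c d → |F (swap c d * σ) - F (swap c' d' * σ')| ≤ B) :
    |heat T p F σ c d - heat T p F σ' c' d'| ≤ B := by
  have inj : σ.symm c ≠ σ.symm d := by simpa using hcd
  have inj' : σ'.symm c' ≠ σ'.symm d' := by simpa using hcd'
  have conv : ∀ {x y q : ℝ}, 0 ≤ q → q ≤ 1 → |x| ≤ B → |y| ≤ B →
      |q * x + (1 - q) * y| ≤ B := by
    intro x y q hq0 hq1 hx hy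
    rw [abs_le] at hx hy ⊢
    constructor <;> nlinarith
  unfold heat
  rw [hp]
  by_cases hM : Movable T σ c d
  · rw [if_pos hM, if_pos (hm.2 hM)]
    have hF' := hF' hM
    unfold place
    rcases lt_or_gt_of_ne inj with hlt | hlt
    · have h2 := ho.2 hlt
      rw [if_pos hlt, if_pos h2, if_neg (not_lt.2 hlt.le), if_neg (not_lt.2 h2.le), swap_comm d c,
        swap_comm d' c']
      convert conv h0 h1 hF hF' using 2
      ring
    · have h2 : ¬ σ'.symm c' < σ'.symm d' := fun h => not_lt.2 hlt.le (ho.1 h)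
      have h3 := lt_of_le_of_ne (not_lt.1 h2) inj'.symm
      rw [if_neg (not_lt.2 hlt.le), if_neg h2, if_pos hlt, if_pos h3]
      convert conv h0 h1 hF' hF using 2
      ring
  · rw [if_neg hM, if_neg (mt hm.1 hM)]
    exact hF

end Heat

/-! ### Neighbouring slots of an edge: which pairs can interfere. -/

section Slots

variable {n : ℕ} {T : BinaryTree ℝ} {v : List Bool} {σ : Perm (Fin n)} {a b c d : Fin n}

/-- `y` is the last descendant of `v` before `a`. -/
def IsPred (T : BinaryTree ℝ) (v : List Bool) (σ : Perm (Fin n)) (a y : Fin n) : Prop :=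
  IsDescendant T y v ∧ σ.symm y < σ.symm a ∧ Clear (fun c => IsDescendant T c v) σ y a

/-- `y` is the first descendant of `v` after `b`. -/
def IsSucc (T : BinaryTree ℝ) (v : List Bool) (σ : Perm (Fin n)) (b y : Fin n) : Prop :=
  IsDescendant T y v ∧ σ.symm b < σ.symm y ∧ Clear (fun c => IsDescendant T c v) σ b y

theorem IsPred.eq {y z : Fin n} (hy : IsPred T v σ a y) (hz : IsPred T v σ a z) : y = z := by
  obtain ⟨hy1, hy2, hy3⟩ := hy
  obtain ⟨hz1, hz2, hz3⟩ := hz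
  have h1 := hy3 z
  have h2 := hz3 y
  by_contra hne
  have : σ.symm y ≠ σ.symm z := by simpa using hne
  grind

theorem IsSucc.eq {y z : Fin n} (hy : IsSucc T v σ b y) (hz : IsSucc T v σ b z) : y = z := by
  obtain ⟨hy1, hy2, hy3⟩ := hy
  obtain ⟨hz1, hz2, hz3⟩ := hz
  have h1 := hy3 z
  have h2 := hz3 y
  by_contra hne
  have : σ.symm y ≠ σ.symm z := by simpa using hne
  grind

/-- This and the next three such lemmas treat the harmful moves: the partner is a right or a left
element, the slot is before `a` or after `b`. Each identifies the partner as the unique neighbour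
and records how the counts h and r of the resulting edge differ by one. -/
theorem IsEdge.right_clear_left (he : IsEdge T v σ a b) (hd : InRight T v d) (hdb : d ≠ b)
    (hm : Clear (fun c => IsDescendant T c v) σ a d) :
    IsPred T v σ a d ∧ IsEdge T v (swap a d * σ) a d ∧
      numBefore (fun c => InLeft T v c) (swap a d * σ) a =
        numBefore (fun c => InLeft T v c) σ a ∧
      numBefore (fun c => InRight T v c) σ a =
        numBefore (fun c => InRight T v c) (swap a d * σ) a + 1 := by
  have had : a ≠ d := by rintro rfl; exact he.left.not_inRight hd
  -- If `d` came after `a`, then either `b` would lie between `a` and `d`, or `d` between `a` and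
  -- `b`.
  have hda : σ.symm d < σ.symm a := by
    have h1 := hm b
    have h2 := he.clear d
    have h3 := he.lt
    have h4 := he.right.isDescendant
    have h5 := hd.isDescendant
    have : σ.symm d ≠ σ.symm b := by simpa using hdb
    have : σ.symm a ≠ σ.symm d := by simpa using had
    grind
  have ha := he.left.isDescendant
  refine ⟨⟨hd.isDescendant, hda, hm.symm⟩, ⟨he.left, hd, ?_, ?_⟩, ?_, ?_⟩
  · simpa [swap_mul_symm_apply] using hda
  · exact clear_swap_mul.2 hm
  · refine numBefore_congr fun x hx => hm.swap_symm_lt_iff (InLeft.isDescendant hx) ha ?_ ?_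
    · rintro ⟨rfl, h⟩; exact had h
    · rintro ⟨rfl, h⟩; exact hx.not_inRight hd
  · refine numBefore_succ (e := d) hd ?_ hda fun x hx hxd => (hm.swap_symm_lt_iff
      (InRight.isDescendant hx) ha ?_ ?_).symm
    · simpa [swap_mul_symm_apply] using hda.le
    · rintro ⟨rfl, h⟩; exact had h
    · rintro ⟨rfl, h⟩; exact hxd rfl

/-- In the swapped state `a` occupies the place of `b`, so a free right partner is the neighbour
after `b`. -/
theorem IsEdge.right_clear_right (he : IsEdge T v σ a b) (hd : InRight T v d) (hdb : d ≠ b)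
    (hm : Clear (fun c => IsDescendant T c v) (swap a b * σ) a d) :
    IsSucc T v σ b d ∧ IsEdge T v (swap a b * σ) a d ∧
      numBefore (fun c => InLeft T v c) (swap a b * σ) a =
        numBefore (fun c => InLeft T v c) σ a ∧
      numBefore (fun c => InRight T v c) (swap a b * σ) a =
        numBefore (fun c => InRight T v c) σ a + 1 := by
  have had : d ≠ a := by rintro rfl; exact he.left.not_inRight hd
  have hab : a ≠ b := by rintro rfl; exact he.left.not_inRight he.right
  have ha := he.left.isDescendant
  have e1 : (swap a b * σ).symm a = σ.symm b := by simp [swap_mul_symm_apply]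
  have e2 : (swap a b * σ).symm b = σ.symm a := by simp [swap_mul_symm_apply]
  have e3 : (swap a b * σ).symm d = σ.symm d := by
    simp [swap_mul_symm_apply, swap_apply_of_ne_of_ne had hdb]
  have hda : σ.symm b < σ.symm d := by
    have h1 := hm b
    have h2 := he.clear d
    have h3 := he.lt
    have h4 := he.right.isDescendant
    have h5 := hd.isDescendant
    have : σ.symm d ≠ σ.symm b := by simpa using hdb
    have : σ.symm d ≠ σ.symm a := by simpa using had
    rw [e1, e2, e3] at h1
    grind
  refine ⟨⟨hd.isDescendant, hda, ?_⟩, ⟨he.left, hd, by rwa [e1, e3], hm⟩, ?_, ?_⟩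
  · intro x hx hS
    have h1 := hm x
    have h2 := he.lt
    have hxa : x ≠ a := by rintro rfl; have := he.lt; grind
    have hxb : x ≠ b := by rintro rfl; grind
    rw [e1, e3, swap_mul_symm_apply, swap_apply_of_ne_of_ne hxa hxb] at h1
    exact h1 hx hS
  · refine numBefore_congr fun x hx => he.clear.swap_symm_lt_iff (InLeft.isDescendant hx) ha ?_ ?_
    · rintro ⟨rfl, h⟩; exact hab h
    · rintro ⟨rfl, h⟩; exact hx.not_inRight he.right
  · refine numBefore_succ (e := b) he.right (not_lt.2 he.lt.le) (by rw [e1, e2]; exact he.lt)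
      fun x hx hxb => he.clear.swap_symm_lt_iff (InRight.isDescendant hx) ha ?_ ?_
    · rintro ⟨rfl, h⟩; exact hab h
    · rintro ⟨rfl, h⟩; exact hxb rfl

theorem IsEdge.lt_iff_lt (he : IsEdge T v σ a b) {x : Fin n} (hx : IsDescendant T x v)
    (hxa : x ≠ a) : σ.symm x < σ.symm b ↔ σ.symm x < σ.symm a := by
  have h1 := he.clear x
  have h2 := he.lt
  have : σ.symm x ≠ σ.symm a := by simpa using hxa
  grind

theorem IsEdge.left_clear_right (he : IsEdge T v σ a b) (hc : InLeft T v c) (hca : c ≠ a)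
    (hm : Clear (fun c => IsDescendant T c v) σ c b) :
    IsSucc T v σ b c ∧ IsEdge T v (swap c b * σ) c b ∧
      numBefore (fun c => InLeft T v c) (swap c b * σ) c =
        numBefore (fun c => InLeft T v c) σ a + 1 ∧
      numBefore (fun c => InRight T v c) (swap c b * σ) c =
        numBefore (fun c => InRight T v c) σ a := by
  have hcb : c ≠ b := by rintro rfl; exact hc.not_inRight he.right
  have hab : a ≠ b := by rintro rfl; exact he.left.not_inRight he.right
  have e1 : (swap c b * σ).symm c = σ.symm b := by simp [swap_mul_symm_apply]
  have e2 : (swap c b * σ).symm b = σ.symm c := by simp [swap_mul_symm_apply]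
  have e3 : ∀ x, x ≠ c → x ≠ b → (swap c b * σ).symm x = σ.symm x := fun x h1 h2 => by
    simp [swap_mul_symm_apply, swap_apply_of_ne_of_ne h1 h2]
  have hbc : σ.symm b < σ.symm c := by
    have h1 := hm a
    have h2 := he.clear c
    have h3 := he.lt
    have h4 := he.left.isDescendant
    have h5 := hc.isDescendant
    have : σ.symm c ≠ σ.symm b := by simpa using hcb
    have : σ.symm c ≠ σ.symm a := by simpa using hca
    grind
  refine ⟨⟨hc.isDescendant, hbc, hm.symm⟩, ⟨hc, he.right, by rwa [e1, e2],
    clear_swap_mul.2 hm⟩, ?_, ?_⟩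
  · refine numBefore_succ (e := a) he.left (lt_irrefl _)
      (by rw [e1, e3 a hca.symm hab]; exact he.lt) fun x hx hxa => ?_
    rw [e1]
    by_cases hxc : x = c
    · subst hxc
      rw [e1]
      have := he.lt
      grind
    · rw [e3 x hxc (by rintro rfl; exact hx.not_inRight he.right)]
      exact he.lt_iff_lt hx.isDescendant hxa
  · refine numBefore_congr fun x hx => ?_
    rw [e1]
    by_cases hxb : x = b
    · subst hxb
      rw [e2]
      have := he.lt
      grind
    · rw [e3 x (by rintro rfl; exact hc.not_inRight hx) hxb]
      exact he.lt_iff_lt hx.isDescendant (by rintro rfl; exact he.left.not_inRight hx)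

theorem IsEdge.left_clear_left (he : IsEdge T v σ a b) (hc : InLeft T v c) (hca : c ≠ a)
    (hm : Clear (fun c => IsDescendant T c v) (swap a b * σ) c b) :
    IsPred T v σ a c ∧ IsEdge T v (swap a b * σ) c b ∧
      numBefore (fun c => InLeft T v c) σ a =
        numBefore (fun c => InLeft T v c) (swap a b * σ) c + 1 ∧
      numBefore (fun c => InRight T v c) (swap a b * σ) c =
        numBefore (fun c => InRight T v c) σ a := by
  have hcb : c ≠ b := by rintro rfl; exact hc.not_inRight he.right
  have hab : a ≠ b := by rintro rfl; exact he.left.not_inRight he.right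
  have e1 : (swap a b * σ).symm a = σ.symm b := by simp [swap_mul_symm_apply]
  have e2 : (swap a b * σ).symm b = σ.symm a := by simp [swap_mul_symm_apply]
  have e3 : ∀ x, x ≠ a → x ≠ b → (swap a b * σ).symm x = σ.symm x := fun x h1 h2 => by
    simp [swap_mul_symm_apply, swap_apply_of_ne_of_ne h1 h2]
  have hlt := he.lt
  have hac : σ.symm c < σ.symm a := by
    have h1 := hm a
    have h2 := he.clear c
    have h4 := he.left.isDescendant
    have h5 := hc.isDescendant
    have : σ.symm c ≠ σ.symm b := by simpa using hcb
    have : σ.symm c ≠ σ.symm a := by simpa using hca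
    rw [e1, e2, e3 c hca hcb] at h1
    grind
  have hclear : Clear (fun c => IsDescendant T c v) σ c a := by
    intro x hx hS
    have h1 := hm x
    have hxa : x ≠ a := by rintro rfl; grind
    have hxb : x ≠ b := by rintro rfl; grind
    rw [e2, e3 c hca hcb, e3 x hxa hxb] at h1
    exact h1 hx hS
  have key : ∀ x : Fin n, IsDescendant T x v → x ≠ c →
      (σ.symm x < σ.symm c ↔ σ.symm x < σ.symm a) := by
    intro x hx hxc
    have h1 := hclear x
    have : σ.symm x ≠ σ.symm c := by simpa using hxc
    grind
  refine ⟨⟨hc.isDescendant, hac, hclear⟩, ⟨hc, he.right, by rwa [e2, e3 c hca hcb], hm⟩,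
    ?_, ?_⟩
  · refine numBefore_succ (e := c) hc (lt_irrefl _) hac fun x hx hxc => ?_
    rw [e3 c hca hcb]
    by_cases hxa : x = a
    · subst hxa
      rw [e1]
      grind
    · rw [e3 x hxa (by rintro rfl; exact hx.not_inRight he.right)]
      exact (key x hx.isDescendant hxc).symm
  · refine numBefore_congr fun x hx => ?_
    rw [e3 c hca hcb]
    by_cases hxb : x = b
    · subst hxb
      rw [e2]
      grind
    · rw [e3 x (by rintro rfl; exact he.left.not_inRight hx) hxb]
      exact key x hx.isDescendant (by rintro rfl; exact hc.not_inRight hx)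

/-- The elements counted, together with `a` and `b`, are distinct descendants of `v`. This makes the
factor m-1-(h+r) of the weight at least 1. -/
theorem IsEdge.numBefore_add_le (he : IsEdge T v σ a b) :
    numBefore (fun c => InLeft T v c) σ a + numBefore (fun c => InRight T v c) σ a + 2 ≤
      nodeSize n T v := by
  classical
  have hab : a ≠ b := by rintro rfl; exact he.left.not_inRight he.right
  unfold numBefore nodeSize
  rw [Nat.card_eq_fintype_card, Fintype.card_subtype, ← Finset.card_union_of_disjoint,
    ← Finset.card_pair hab, ← Finset.card_union_of_disjoint]
  · refine Finset.card_le_card fun x => ?_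
    simp only [Finset.mem_union, Finset.mem_filter, Finset.mem_univ, true_and, Finset.mem_insert,
      Finset.mem_singleton]
    rintro ((⟨h, -⟩ | ⟨h, -⟩) | (rfl | rfl))
    · exact h.isDescendant
    · exact h.isDescendant
    · exact he.left.isDescendant
    · exact he.right.isDescendant
  · rw [Finset.disjoint_left]
    have := he.lt
    intro x
    simp only [Finset.mem_union, Finset.mem_filter, Finset.mem_univ, true_and, Finset.mem_insert,
      Finset.mem_singleton]
    rintro h (rfl | rfl)
    · exact absurd h (by simp)
    · rcases h with h | h <;> exact absurd h.2 (not_lt.2 this.le)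
  · rw [Finset.disjoint_left]
    intro x
    simp only [Finset.mem_filter, Finset.mem_univ, true_and]
    rintro ⟨h, -⟩ ⟨h', -⟩
    exact h.not_inRight h'

theorem nodeSize_le (n : ℕ) (T : BinaryTree ℝ) (v : List Bool) : nodeSize n T v ≤ n := by
  classical
  unfold nodeSize
  rw [Nat.card_eq_fintype_card]
  simpa using Fintype.card_subtype_le (fun c : Fin n => IsDescendant T c v)

end Slots

/-! ### Transition probability times the weight of a neighbouring edge. -/

section SlotWeight

variable {γ κ p : ℝ} {m h r : ℕ}

/-- In these four lemmas the neighbouring edge's exponential factor differs by γ or 1/γ from that of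
the current edge. An inversion is undone with probability p and meets 1/γ; one is created with
probability 1-p, here also called `p`, and meets γ. In all cases κ remains, times the quadratic
factor at j-1 or j+1. -/
theorem mul_slotWeight_le_right (hγ : 0 < γ) (hp : p ≤ κ * γ) (hm : h + r + 2 ≤ m) :
    p * slotWeight γ m h r ≤
      κ * (γ ^ (r + 1) * γ⁻¹ ^ h * (((h : ℝ) + (r + 1 : ℕ)) * (m - (h + (r + 1 : ℕ))))) := by
  have hm' : (h : ℝ) + r + 2 ≤ m := by exact_mod_cast hm
  have h0 : 0 ≤ γ ^ r * γ⁻¹ ^ h * (((h : ℝ) + r + 1) * (m - 1 - (h + r))) :=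
    mul_nonneg (by positivity) (mul_nonneg (by positivity) (by linarith))
  have := mul_le_mul_of_nonneg_right hp h0
  unfold slotWeight
  refine this.trans_eq ?_
  push_cast
  ring

theorem mul_slotWeight_le_left (hγ : 0 < γ) (hp : p * γ ≤ κ) (hm : h + r + 2 ≤ m) :
    p * slotWeight γ m h r ≤
      κ * (γ ^ r * γ⁻¹ ^ (h + 1) * ((((h + 1 : ℕ) : ℝ) + r) * (m - ((h + 1 : ℕ) + r)))) := by
  have hm' : (h : ℝ) + r + 2 ≤ m := by exact_mod_cast hm
  have h0 : 0 ≤ γ ^ r * γ⁻¹ ^ (h + 1) * (((h : ℝ) + r + 1) * (m - 1 - (h + r))) :=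
    mul_nonneg (by positivity) (mul_nonneg (by positivity) (by linarith))
  have := mul_le_mul_of_nonneg_right hp h0
  unfold slotWeight
  refine Eq.trans_le ?_ (this.trans_eq ?_)
  · rw [pow_succ]; field_simp
  · push_cast
    ring

theorem mul_slotWeight_succ_le_left (hγ : 0 < γ) (hp : p ≤ κ * γ) (hm : h + 1 + r + 2 ≤ m) :
    p * slotWeight γ m (h + 1) r ≤
      κ * (γ ^ r * γ⁻¹ ^ h * (((h : ℝ) + r + 2) * (m - 2 - (h + r)))) := by
  have hm' : (h : ℝ) + 1 + r + 2 ≤ m := by exact_mod_cast hm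
  have h0 : 0 ≤ γ ^ r * γ⁻¹ ^ (h + 1) * (((h : ℝ) + r + 2) * (m - 2 - (h + r))) :=
    mul_nonneg (by positivity) (mul_nonneg (by positivity) (by linarith))
  have := mul_le_mul_of_nonneg_right hp h0
  unfold slotWeight
  refine Eq.trans_le ?_ (this.trans_eq ?_)
  · push_cast; ring
  · rw [pow_succ]; field_simp

theorem mul_slotWeight_succ_le_right (hγ : 0 < γ) (hp : p * γ ≤ κ) (hm : h + (r + 1) + 2 ≤ m) :
    p * slotWeight γ m h (r + 1) ≤
      κ * (γ ^ r * γ⁻¹ ^ h * (((h : ℝ) + r + 2) * (m - 2 - (h + r)))) := by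
  have hm' : (h : ℝ) + (r + 1) + 2 ≤ m := by exact_mod_cast hm
  have h0 : 0 ≤ γ ^ r * γ⁻¹ ^ h * (((h : ℝ) + r + 2) * (m - 2 - (h + r))) :=
    mul_nonneg (by positivity) (mul_nonneg (by positivity) (by linarith))
  have := mul_le_mul_of_nonneg_right hp h0
  unfold slotWeight
  refine Eq.trans_le ?_ (this.trans_eq ?_)
  · push_cast; ring
  · ring

end SlotWeight

/-! ### Effect of each pair on the two endpoints of an edge. -/

section Contraction

variable {n : ℕ} {T : BinaryTree ℝ} {p : Fin n → Fin n → ℝ} {γ : List Bool → ℝ} {κ ρ : ℝ}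
  {v : List Bool} {σ : Perm (Fin n)} {a b c d : Fin n} {F : Perm (Fin n) → ℝ} {D : ℝ}

/-- The base `γ` of the edge weights is compatible with the probabilities `p`, and `ρ` is the
resulting rate of contraction. -/
structure IsContracting (T : BinaryTree ℝ) (p : Fin n → Fin n → ℝ) (γ : List Bool → ℝ)
    (κ ρ : ℝ) : Prop where
  numLeaves : T.numLeaves = n
  congr : ∀ a b c d : Fin n, a < b → c < d → lca T a b = lca T c d → p a b = p c d
  nonneg : ∀ a b : Fin n, a < b → 0 ≤ p a b
  le_one : ∀ a b : Fin n, a < b → p a b ≤ 1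
  base_pos : ∀ v, 0 < γ v
  le_mul : ∀ a b : Fin n, a < b → p a b ≤ κ * γ (lca T a b)
  mul_le : ∀ a b : Fin n, a < b → (1 - p a b) * γ (lca T a b) ≤ κ
  rate_nonneg : 0 ≤ κ
  gap : ∀ m j : ℕ, j + 2 ≤ m → m ≤ n →
    κ * ((j : ℝ) * (m - j) + (j + 2) * (m - 2 - j)) ≤ (1 - ρ) * ((j + 1) * (m - 1 - j))

/-- `F` changes by at most `D` times the weight along each edge. -/
def IsLip (T : BinaryTree ℝ) (γ : List Bool → ℝ) (F : Perm (Fin n) → ℝ) (D : ℝ) : Prop :=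
  ∀ (v : List Bool) (σ : Perm (Fin n)) (a b : Fin n), IsEdge T v σ a b →
    |F σ - F (swap a b * σ)| ≤ D * edgeWeight T γ v σ a

theorem fin_lt_of_inLeft_inRight (hT : T.numLeaves = n) (hc : InLeft T v c) (hd : InRight T v d) : c < d :=
  Fin.lt_def.2 (lt_of_inLeft_inRight hc hd (hT ▸ c.2))

theorem movable_iff (hc : InLeft T v c) (hd : InRight T v d) :
    Movable T σ c d ↔ Clear (fun c => IsDescendant T c v) σ c d := by
  unfold Movable Clear
  rw [lca_eq hc hd]

theorem heat_of_not_movable (h : ¬ Movable T σ c d) : heat T p F σ c d = F σ := if_neg h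

theorem heat_sub_of_lt (h : Movable T σ c d) (hlt : σ.symm c < σ.symm d) :
    heat T p F σ c d - F σ = -(1 - p c d) * (F σ - F (swap c d * σ)) := by
  rw [heat, if_pos h, place, place, if_pos hlt, if_neg (not_lt.2 hlt.le), swap_comm d c]
  ring

theorem heat_sub_of_gt (h : Movable T σ c d) (hlt : σ.symm d < σ.symm c) :
    heat T p F σ c d - F σ = p c d * (F (swap c d * σ) - F σ) := by
  rw [heat, if_pos h, place, place, if_pos hlt, if_neg (not_lt.2 hlt.le)]
  ring

open scoped Classical in
/-- The bound for the effect of the two slots of `v` next to the one occupied by `a` and `b`. -/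
noncomputable def extra (T : BinaryTree ℝ) (v : List Bool) (σ : Perm (Fin n)) (a b : Fin n)
    (B C : ℝ) (y : Fin n) : ℝ :=
  (if IsPred T v σ a y then B else 0) + (if IsSucc T v σ b y then C else 0)

/-- The contribution of the slot before `a`. -/
noncomputable def slotBefore (T : BinaryTree ℝ) (γ : List Bool → ℝ) (κ D : ℝ) (v : List Bool)
    (σ : Perm (Fin n)) (a : Fin n) : ℝ :=
  let h := numBefore (fun c => InLeft T v c) σ a
  let r := numBefore (fun c => InRight T v c) σ a
  D * (κ * (γ v ^ r * (γ v)⁻¹ ^ h * (((h : ℝ) + r) * (nodeSize n T v - (h + r)))))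

/-- The contribution of the slot after `b`. -/
noncomputable def slotAfter (T : BinaryTree ℝ) (γ : List Bool → ℝ) (κ D : ℝ) (v : List Bool)
    (σ : Perm (Fin n)) (a : Fin n) : ℝ :=
  let h := numBefore (fun c => InLeft T v c) σ a
  let r := numBefore (fun c => InRight T v c) σ a
  D * (κ * (γ v ^ r * (γ v)⁻¹ ^ h * (((h : ℝ) + r + 2) * (nodeSize n T v - 2 - (h + r)))))

theorem abs_mul_le_of_abs_le {q x E w B : ℝ} (hq : 0 ≤ q) (hD : 0 ≤ D) (hx : |x| ≤ D * w)
    (hB : q * w ≤ B) (hE : E = D * B) : |q * x| ≤ E := by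
  rw [abs_mul, abs_of_nonneg hq, hE]
  calc q * |x| ≤ q * (D * w) := mul_le_mul_of_nonneg_left hx hq
    _ = D * (q * w) := by ring
    _ ≤ D * B := mul_le_mul_of_nonneg_left hB hD

open scoped Classical in
theorem abs_heat_sub_self_le {P : Prop} {B : ℝ} (hB : 0 ≤ B)
    (h : Movable T σ c d → P ∧ |heat T p F σ c d - F σ| ≤ B) :
    |heat T p F σ c d - F σ| ≤ if P then B else 0 := by
  by_cases hM : Movable T σ c d
  · rw [if_pos (h hM).1]
    exact (h hM).2
  · rw [heat_of_not_movable hM, sub_self, abs_zero]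
    split_ifs <;> simp [hB]

/-- For interfering pairs no parallel motion is available; the triangle inequality adds each
endpoint's own displacement. -/
theorem abs_heat_sub_heat_le {A B C : ℝ} {σ' : Perm (Fin n)} (hA : |F σ - F σ'| ≤ A)
    (hB : |heat T p F σ c d - F σ| ≤ B) (hC : |heat T p F σ' c d - F σ'| ≤ C) :
    |heat T p F σ c d - heat T p F σ' c d| ≤ A + (B + C) := by
  have h4 : heat T p F σ c d - heat T p F σ' c d =
    (F σ - F σ') + (heat T p F σ c d - F σ) - (heat T p F σ' c d - F σ') := by ring
  rw [h4]
  have h5 := abs_sub ((F σ - F σ') + (heat T p F σ c d - F σ)) (heat T p F σ' c d - F σ')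
  have h6 := abs_add_le (F σ - F σ') (heat T p F σ c d - F σ)
  linarith

theorem slotBefore_nonneg (hC : IsContracting T p γ κ ρ) (hD : 0 ≤ D) (he : IsEdge T v σ a b) :
    0 ≤ slotBefore T γ κ D v σ a := by
  have := hC.base_pos v
  have := hC.rate_nonneg
  have h1 : ((_ : ℕ) : ℝ) ≤ ((_ : ℕ) : ℝ) := Nat.cast_le.2 he.numBefore_add_le
  push_cast at h1
  unfold slotBefore
  refine mul_nonneg hD (mul_nonneg (by assumption) (mul_nonneg (by positivity)
    (mul_nonneg (by positivity) (by linarith))))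

theorem slotAfter_nonneg (hC : IsContracting T p γ κ ρ) (hD : 0 ≤ D) (he : IsEdge T v σ a b) :
    0 ≤ slotAfter T γ κ D v σ a := by
  have := hC.base_pos v
  have := hC.rate_nonneg
  have h1 : ((_ : ℕ) : ℝ) ≤ ((_ : ℕ) : ℝ) := Nat.cast_le.2 he.numBefore_add_le
  push_cast at h1
  unfold slotAfter
  refine mul_nonneg hD (mul_nonneg (by assumption) (mul_nonneg (by positivity)
    (mul_nonneg (by positivity) (by linarith))))

theorem abs_heat_sub_left_le (hC : IsContracting T p γ κ ρ) (hF : IsLip T γ F D) (hD : 0 ≤ D)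
    (he : IsEdge T v σ a b) (hd : InRight T v d) (hdb : d ≠ b) :
    |heat T p F σ a d - heat T p F (swap a b * σ) a d| ≤
      D * edgeWeight T γ v σ a +
        extra T v σ a b (slotBefore T γ κ D v σ a) (slotAfter T γ κ D v σ a) d := by
  have had := fin_lt_of_inLeft_inRight hC.numLeaves he.left hd
  have hlca : lca T a d = v := lca_eq he.left hd
  refine abs_heat_sub_heat_le (hF _ _ _ _ he)
    (abs_heat_sub_self_le (slotBefore_nonneg hC hD he) fun hM => ?_)
    (abs_heat_sub_self_le (slotAfter_nonneg hC hD he) fun hM => ?_)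
  · obtain ⟨hP, hE, e1, e2⟩ := he.right_clear_left hd hdb ((movable_iff he.left hd).1 hM)
    refine ⟨hP, ?_⟩
    rw [heat_sub_of_gt hM hP.2.1]
    have h2 := hF _ _ _ _ hE
    rw [swap_swap_mul] at h2
    have h3 := mul_slotWeight_le_right (hC.base_pos v) (hlca ▸ hC.le_mul a d had)
      hE.numBefore_add_le
    refine abs_mul_le_of_abs_le (hC.nonneg a d had) hD h2 h3 ?_
    rw [slotBefore, ← e2, ← e1]
  · obtain ⟨hP, hE, e1, e2⟩ := he.right_clear_right hd hdb ((movable_iff he.left hd).1 hM)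
    refine ⟨hP, ?_⟩
    rw [heat_sub_of_lt hM hE.lt, neg_mul, abs_neg]
    have h2 := hF _ _ _ _ hE
    have h4 := hE.numBefore_add_le
    rw [edgeWeight, e1, e2] at h2
    rw [e1, e2] at h4
    exact abs_mul_le_of_abs_le (sub_nonneg.2 (hC.le_one a d had)) hD h2
      (mul_slotWeight_succ_le_right (hC.base_pos v) (hlca ▸ hC.mul_le a d had) h4) rfl

open scoped Classical in
theorem abs_heat_sub_right_le (hC : IsContracting T p γ κ ρ) (hF : IsLip T γ F D) (hD : 0 ≤ D)
    (he : IsEdge T v σ a b) (hc : InLeft T v c) (hca : c ≠ a) :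
    |heat T p F σ c b - heat T p F (swap a b * σ) c b| ≤
      D * edgeWeight T γ v σ a +
        extra T v σ a b (slotBefore T γ κ D v σ a) (slotAfter T γ κ D v σ a) c := by
  have hcb := fin_lt_of_inLeft_inRight hC.numLeaves hc he.right
  have hlca : lca T c b = v := lca_eq hc he.right
  rw [extra, add_comm (ite (IsPred T v σ a c) _ _)]
  refine abs_heat_sub_heat_le (hF _ _ _ _ he)
    (abs_heat_sub_self_le (slotAfter_nonneg hC hD he) fun hM => ?_)
    (abs_heat_sub_self_le (slotBefore_nonneg hC hD he) fun hM => ?_)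
  · obtain ⟨hP, hE, e1, e2⟩ := he.left_clear_right hc hca ((movable_iff hc he.right).1 hM)
    refine ⟨hP, ?_⟩
    rw [heat_sub_of_gt hM hP.2.1]
    have h2 := hF _ _ _ _ hE
    have h4 := hE.numBefore_add_le
    rw [swap_swap_mul, edgeWeight, e1, e2] at h2
    rw [e1, e2] at h4
    exact abs_mul_le_of_abs_le (hC.nonneg c b hcb) hD h2
      (mul_slotWeight_succ_le_left (hC.base_pos v) (hlca ▸ hC.le_mul c b hcb) h4) rfl
  · obtain ⟨hP, hE, e1, e2⟩ := he.left_clear_left hc hca ((movable_iff hc he.right).1 hM)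
    refine ⟨hP, ?_⟩
    rw [heat_sub_of_lt hM hE.lt, neg_mul, abs_neg]
    have h2 := hF _ _ _ _ hE
    have h3 := mul_slotWeight_le_left (hC.base_pos v) (hlca ▸ hC.mul_le c b hcb)
      hE.numBefore_add_le
    refine abs_mul_le_of_abs_le (sub_nonneg.2 (hC.le_one c b hcb)) hD h2 h3 ?_
    rw [slotBefore, ← e1, ← e2]

/-- The endpoints differ only in the order of `a` and `b`, which the step resamples. This is the
whole gain of the contraction. -/
theorem heat_sub_heat_edge (he : IsEdge T v σ a b) :
    heat T p F σ a b - heat T p F (swap a b * σ) a b = 0 := by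
  have h1 : Movable T σ a b := (movable_iff he.left he.right).2 he.clear
  have h2 : Movable T (swap a b * σ) a b :=
    (movable_iff he.left he.right).2 (clear_swap_mul.2 he.clear)
  have h3 := heat_sub_of_lt (p := p) (F := F) h1 he.lt
  have h4 := heat_sub_of_gt (p := p) (F := F) h2 (by simpa [swap_mul_symm_apply] using he.lt)
  rw [swap_swap_mul] at h4
  linarith

theorem swap_apply_mul (t : Perm (Fin n)) (c d : Fin n) :
    swap (t c) (t d) * (t * σ) = t * (swap c d * σ) := by
  rw [← mul_assoc, ← mul_swap_eq_swap_mul, mul_assoc]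

/-- Nodes strictly above `v`. -/
theorem abs_heat_sub_above_le (hC : IsContracting T p γ κ ρ) (hF : IsLip T γ F D)
    (he : IsEdge T v σ a b) (hcd : c < d) {x : Bool} (h : (lca T c d ++ [x]) <+: v) :
    swap a b c < swap a b d ∧ lca T (swap a b c) (swap a b d) = lca T c d ∧
    |heat T p F σ c d - heat T p F (swap a b * σ) (swap a b c) (swap a b d)| ≤
      D * edgeWeight T γ v σ a := by
  have hdT : (d : ℕ) < T.numLeaves := hC.numLeaves ▸ d.2
  have hc : InLeft T (lca T c d) c := inLeft_lca hcd hdT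
  have hd : InRight T (lca T c d) d := inRight_lca hcd hdT
  have hs := same_side h he.left.isDescendant he.right.isDescendant
  have huv : lca T c d <+: v := (List.prefix_append _ [x]).trans h
  have hc' : InLeft T (lca T c d) (swap a b c) :=
    (swap_apply_iff (S := fun y : Fin n => InLeft T (lca T c d) y) hs.1 c).2 hc
  have hd' : InRight T (lca T c d) (swap a b d) :=
    (swap_apply_iff (S := fun y : Fin n => InRight T (lca T c d) y) hs.2 d).2 hd
  have hcd' := fin_lt_of_inLeft_inRight hC.numLeaves hc' hd'
  have hlca := lca_eq hc' hd'
  refine ⟨hcd', hlca, heat_sub_heat_le hcd.ne hcd'.ne (hC.nonneg c d hcd) (hC.le_one c d hcd)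
    (hC.congr _ _ _ _ hcd' hcd hlca) ?_ ?_ (hF _ _ _ _ he) fun hM => ?_⟩
  · rw [movable_iff hc' hd', movable_iff hc hd]
    refine clear_relabel (S := fun y : Fin n => IsDescendant T y (lca T c d)) _
      (swap_apply_iff (S := fun y : Fin n => IsDescendant T y (lca T c d)) ?_)
    exact iff_of_true (isDescendant_of_prefix huv he.left.isDescendant)
      (isDescendant_of_prefix huv he.right.isDescendant)
  · simp only [mul_symm_apply_apply]
  · obtain ⟨hE, e⟩ := he.above h hc hd ((movable_iff hc hd).1 hM) γ
    have h1 := hF _ _ _ _ hE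
    rw [e] at h1
    rwa [swap_apply_mul]

/-- The node `v` itself, with pairs disjoint from `a` and `b`. -/
theorem abs_heat_sub_disjoint_le (hC : IsContracting T p γ κ ρ) (hF : IsLip T γ F D)
    (he : IsEdge T v σ a b) (hc : InLeft T v c) (hd : InRight T v d) (hca : c ≠ a)
    (hdb : d ≠ b) :
    |heat T p F σ c d - heat T p F (swap a b * σ) c d| ≤ D * edgeWeight T γ v σ a := by
  have hcd := fin_lt_of_inLeft_inRight hC.numLeaves hc hd
  have hda : d ≠ a := by rintro rfl; exact he.left.not_inRight hd
  have hcb : c ≠ b := by rintro rfl; exact hc.not_inRight he.right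
  have key : ∀ y z : Fin n, IsDescendant T y v → IsDescendant T z v →
      (y = c ∨ y = d ∨ z = c ∨ z = d) →
      ((swap a b * σ).symm y < (swap a b * σ).symm z ↔ σ.symm y < σ.symm z) := by
    intro y z hy hz h
    refine he.clear.swap_symm_lt_iff hy hz ?_ ?_
    · rintro ⟨rfl, rfl⟩; tauto
    · rintro ⟨rfl, rfl⟩; tauto
  have hcS := hc.isDescendant
  have hdS := hd.isDescendant
  refine heat_sub_heat_le hcd.ne hcd.ne (hC.nonneg c d hcd) (hC.le_one c d hcd) rfl ?_
    (key _ _ hcS hdS (by simp)) (hF _ _ _ _ he) fun hM => ?_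
  · rw [movable_iff hc hd, movable_iff hc hd]
    constructor <;> intro h <;> refine h.congr_order ?_ ?_ ?_ ?_ <;> intro y hy <;>
      first
        | exact key _ _ (by assumption) (by assumption) (by simp)
        | exact (key _ _ (by assumption) (by assumption) (by simp)).symm
  · obtain ⟨hE, e⟩ := he.disjoint hc hd hca hdb ((movable_iff hc hd).1 hM) γ
    have h1 := hF _ _ _ _ hE
    rw [e] at h1
    rwa [← swap_apply_mul, swap_apply_of_ne_of_ne hca hcb, swap_apply_of_ne_of_ne hda hdb] at h1

/-- Nodes below `v` or unrelated to `v`. -/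
theorem abs_heat_sub_below_le (hC : IsContracting T p γ κ ρ) (hF : IsLip T γ F D)
    (he : IsEdge T v σ a b) (hcd : c < d)
    (h : (∃ x, (v ++ [x]) <+: lca T c d) ∨
      ∀ c', IsDescendant T c' (lca T c d) → ¬ IsDescendant T c' v) :
    |heat T p F σ c d - heat T p F (swap a b * σ) c d| ≤ D * edgeWeight T γ v σ a := by
  have hdT : (d : ℕ) < T.numLeaves := hC.numLeaves ▸ d.2
  have hc : InLeft T (lca T c d) c := inLeft_lca hcd hdT
  have hd : InRight T (lca T c d) d := inRight_lca hcd hdT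
  have hcS := hc.isDescendant
  have hdS := hd.isDescendant
  have key : ∀ y z : Fin n, IsDescendant T y (lca T c d) → IsDescendant T z (lca T c d) →
      ((swap a b * σ).symm y < (swap a b * σ).symm z ↔ σ.symm y < σ.symm z) := by
    intro y z hy hz
    rcases h with ⟨x, h⟩ | h
    · have hvu : v <+: lca T c d := (List.prefix_append _ [x]).trans h
      refine he.clear.swap_symm_lt_iff (isDescendant_of_prefix hvu hy)
        (isDescendant_of_prefix hvu hz) ?_ ?_
      · rintro ⟨rfl, rfl⟩
        exact not_both_of_below h he.left he.right hy hz
      · rintro ⟨rfl, rfl⟩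
        exact not_both_of_below h he.left he.right hz hy
    · have h1 : ∀ y : Fin n, IsDescendant T y (lca T c d) → (swap a b * σ).symm y = σ.symm y := by
        intro y hy
        rw [swap_mul_symm_apply, swap_apply_of_ne_of_ne]
        · rintro rfl; exact h _ hy he.left.isDescendant
        · rintro rfl; exact h _ hy he.right.isDescendant
      rw [h1 y hy, h1 z hz]
  have hside : (InLeft T v c ↔ InLeft T v d) ∧ (InRight T v c ↔ InRight T v d) ∧
      (IsDescendant T c v ↔ IsDescendant T d v) := by
    rcases h with ⟨x, h⟩ | h
    · have hvu : v <+: lca T c d := (List.prefix_append _ [x]).trans h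
      exact ⟨(same_side h hcS hdS).1, (same_side h hcS hdS).2,
        iff_of_true (isDescendant_of_prefix hvu hcS) (isDescendant_of_prefix hvu hdS)⟩
    · exact ⟨iff_of_false (fun h' => h _ hcS h'.isDescendant) fun h' => h _ hdS h'.isDescendant,
        iff_of_false (fun h' => h _ hcS h'.isDescendant) fun h' => h _ hdS h'.isDescendant,
        iff_of_false (h _ hcS) (h _ hdS)⟩
  refine heat_sub_heat_le hcd.ne hcd.ne (hC.nonneg c d hcd) (hC.le_one c d hcd) rfl ?_
    (key _ _ hcS hdS) (hF _ _ _ _ he) fun hM => ?_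
  · rw [movable_iff hc hd, movable_iff hc hd]
    constructor <;> intro h <;> refine h.congr_order ?_ ?_ ?_ ?_ <;> intro y hy <;>
      first
        | exact key _ _ (by assumption) (by assumption)
        | exact (key _ _ (by assumption) (by assumption)).symm
  · obtain ⟨hE, e⟩ := he.relabel (swap c d)
      (swap_apply_iff (S := fun y : Fin n => InLeft T v y) hside.1)
      (swap_apply_iff (S := fun y : Fin n => InRight T v y) hside.2.1)
      (swap_apply_iff (S := fun y : Fin n => IsDescendant T y v) hside.2.2) γ
    have h1 := hF _ _ _ _ hE
    rw [e] at h1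
    rwa [swap_apply_mul] at h1

end Contraction

/-! ### Summation over all pairs and the one-step contraction. -/

section Pairs

variable {n : ℕ} {T : BinaryTree ℝ} {p : Fin n → Fin n → ℝ} {γ : List Bool → ℝ} {κ ρ : ℝ}
  {v : List Bool} {σ : Perm (Fin n)} {a b c d : Fin n} {F : Perm (Fin n) → ℝ} {D : ℝ}

/-- The pairs `a < b`. -/
def pairs (n : ℕ) : Finset (Fin n × Fin n) := Finset.univ.filter fun x => x.1 < x.2

theorem mem_pairs {x : Fin n × Fin n} : x ∈ pairs n ↔ x.1 < x.2 := by simp [pairs]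

theorem sum_pairs (f : Fin n → Fin n → ℝ) :
    ∑ a : Fin n, ∑ b ∈ Finset.Ioi a, f a b = ∑ x ∈ pairs n, f x.1 x.2 := by
  rw [pairs, Finset.sum_filter, Fintype.sum_prod_type]
  refine Finset.sum_congr rfl fun a _ => ?_
  rw [← Finset.sum_filter]
  refine Finset.sum_congr ?_ fun _ _ => rfl
  ext b
  simp

theorem card_pairs (n : ℕ) : (pairs n).card = n.choose 2 := by
  have h : (pairs n).card = ∑ a : Fin n, (Finset.Ioi a).card := by
    have h := sum_pairs (n := n) fun _ _ => 1
    simp only [Finset.sum_const, nsmul_eq_mul, mul_one] at h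
    exact_mod_cast h.symm
  rw [h]
  simp only [Fin.card_Ioi]
  rw [Fin.sum_univ_eq_sum_range (fun i => n - 1 - i) n, Finset.sum_range_reflect (fun i => i) n,
    Finset.sum_range_id, Nat.choose_two_right]

theorem treeChain_mulVec (F : Perm (Fin n) → ℝ) (σ : Perm (Fin n)) :
    (treeChain T p).mulVec F σ =
      1 / (n.choose 2 : ℝ) * ∑ x ∈ pairs n, heat T p F σ x.1 x.2 := by
  classical
  unfold Matrix.mulVec dotProduct treeChain
  simp only [sum_pairs (n := n) (fun _ _ => _)]
  simp only [Finset.sum_mul]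
  rw [Finset.sum_comm, Finset.mul_sum]
  refine Finset.sum_congr rfl fun x _ => ?_
  simp only [mul_assoc, ← Finset.mul_sum]
  congr 1
  unfold heat
  split_ifs
  · simp [add_mul, Finset.sum_add_distrib]
  · simp

open scoped Classical in
/-- The pair that is compared in `swap a b * σ` with the pair `x` in `σ`. -/
noncomputable def matchPair (T : BinaryTree ℝ) (v : List Bool) (a b : Fin n)
    (x : Fin n × Fin n) : Fin n × Fin n :=
  if ∃ y, (lca T x.1 x.2 ++ [y]) <+: v then (swap a b x.1, swap a b x.2) else x

theorem matchPair_mem_and (hC : IsContracting T p γ κ ρ) (he : IsEdge T v σ a b)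
    {x : Fin n × Fin n} (hx : x ∈ pairs n) :
    matchPair T v a b x ∈ pairs n ∧ matchPair T v a b (matchPair T v a b x) = x := by
  by_cases h : ∃ y, (lca T x.1 x.2 ++ [y]) <+: v
  · obtain ⟨y, hy⟩ := h
    -- Used with the zero function only for its first two conclusions, the order and the common
    -- ancestor of the exchanged pair.
    obtain ⟨h1, h2, -⟩ := abs_heat_sub_above_le (D := 0) (F := fun _ => 0) hC
      (fun _ _ _ _ _ => by simp) he (mem_pairs.1 hx) hy
    have e : matchPair T v a b x = (swap a b x.1, swap a b x.2) := if_pos ⟨y, hy⟩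
    rw [e]
    refine ⟨mem_pairs.2 h1, ?_⟩
    rw [matchPair, if_pos ⟨y, by simpa only [h2] using hy⟩]
    simp
  · have e : matchPair T v a b x = x := if_neg h
    rw [e, e]
    exact ⟨hx, rfl⟩

theorem sum_matchPair (hC : IsContracting T p γ κ ρ) (he : IsEdge T v σ a b)
    (f : Fin n × Fin n → ℝ) : ∑ x ∈ pairs n, f (matchPair T v a b x) = ∑ x ∈ pairs n, f x :=
  Finset.sum_nbij' (matchPair T v a b) (matchPair T v a b)
    (fun _ hx => (matchPair_mem_and hC he hx).1) (fun _ hx => (matchPair_mem_and hC he hx).1)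
    (fun _ hx => (matchPair_mem_and hC he hx).2) (fun _ hx => (matchPair_mem_and hC he hx).2)
    (fun _ _ => rfl)

theorem extra_nonneg {B C : ℝ} (hB : 0 ≤ B) (hC : 0 ≤ C) (y : Fin n) :
    0 ≤ extra T v σ a b B C y := by
  unfold extra
  split_ifs <;> positivity

open scoped Classical in
-- The ledger of the coupling: each pair costs the old bound, the edge's own pair costs nothing, and
-- pairs at `v` sharing an element with the edge may cost extra. The cases follow the position of
-- the pair's common ancestor relative to `v`.
theorem abs_heat_sub_matchPair_le (hC : IsContracting T p γ κ ρ) (hF : IsLip T γ F D) (hD : 0 ≤ D)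
    (he : IsEdge T v σ a b) {x : Fin n × Fin n} (hx : x ∈ pairs n) :
    |heat T p F σ x.1 x.2 - heat T p F (swap a b * σ) (matchPair T v a b x).1
        (matchPair T v a b x).2| ≤
      D * edgeWeight T γ v σ a - (if x = (a, b) then D * edgeWeight T γ v σ a else 0) +
        (if x.1 = a ∧ InRight T v x.2 then
          extra T v σ a b (slotBefore T γ κ D v σ a) (slotAfter T γ κ D v σ a) x.2 else 0) +
        (if x.2 = b ∧ InLeft T v x.1 then
          extra T v σ a b (slotBefore T γ κ D v σ a) (slotAfter T γ κ D v σ a) x.1 else 0) := by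
  obtain ⟨c, d⟩ := x
  have hcd : c < d := mem_pairs.1 hx
  have hdT : (d : ℕ) < T.numLeaves := hC.numLeaves ▸ d.2
  have hE := extra_nonneg (T := T) (v := v) (σ := σ) (a := a) (b := b)
    (slotBefore_nonneg hC hD he) (slotAfter_nonneg hC hD he)
  have hlca : ∀ {c d : Fin n}, InLeft T v c → InRight T v d → lca T c d = v := lca_eq
  have hab := hlca he.left he.right
  have hnot : ¬ ∃ y, (v ++ [y]) <+: v := by
    rintro ⟨y, h⟩
    simpa using h.length_le
  by_cases hv : lca T c d = v
  · have hc : InLeft T v c := hv ▸ inLeft_lca hcd hdT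
    have hd : InRight T v d := hv ▸ inRight_lca hcd hdT
    have e : matchPair T v a b (c, d) = (c, d) := by
      rw [matchPair, if_neg]
      simpa only [hv] using hnot
    rw [e]
    dsimp only
    by_cases hca : c = a
    · subst hca
      by_cases hdb : d = b
      · subst hdb
        rw [heat_sub_heat_edge he]
        have := hE c
        have := hE d
        simp [hc, hd]
        positivity
      · have := abs_heat_sub_left_le hC hF hD he hd hdb
        simpa [hdb, hd] using this
    · by_cases hdb : d = b
      · subst hdb
        have := abs_heat_sub_right_le hC hF hD he hc hca
        simpa [hca, hc] using this
      · simpa [hca, hdb] using abs_heat_sub_disjoint_le hC hF he hc hd hca hdb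
  · have h1 : ¬ (c, d) = (a, b) := by
      intro h
      simp only [Prod.mk.injEq] at h
      rw [h.1, h.2] at hv
      exact hv hab
    have h2 : ¬ (c = a ∧ InRight T v d) := by
      rintro ⟨rfl, h⟩
      exact hv (hlca he.left h)
    have h3 : ¬ (d = b ∧ InLeft T v c) := by
      rintro ⟨rfl, h⟩
      exact hv (hlca h he.right)
    dsimp only
    rw [if_neg h1, if_neg h2, if_neg h3, sub_zero, add_zero, add_zero]
    rcases laminar T (lca T c d) v with h | h | h
    · rw [matchPair, if_pos h]
      obtain ⟨y, hy⟩ := h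
      exact (abs_heat_sub_above_le hC hF he hcd hy).2.2
    · exact absurd h hv
    · rw [matchPair, if_neg]
      · exact abs_heat_sub_below_le hC hF he hcd h
      · rintro ⟨y, hy⟩
        have hvu : lca T c d <+: v := (List.prefix_append _ [y]).trans hy
        rcases h with ⟨z, h⟩ | h
        · have := h.length_le.trans hvu.length_le
          simp at this
        · exact h _ (isDescendant_of_prefix hvu he.left.isDescendant) he.left.isDescendant

open scoped Classical in
theorem sum_ite_le_of_unique {P : Fin n → Prop} (h : ∀ x y, P x → P y → x = y) {B : ℝ}
    (hB : 0 ≤ B) : ∑ x, (if P x then B else 0) ≤ B := by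
  rw [← Finset.sum_filter, Finset.sum_const, nsmul_eq_mul]
  have : (Finset.univ.filter P).card ≤ 1 := Finset.card_le_one.2 fun x hx y hy =>
    h x y (by simpa using hx) (by simpa using hy)
  have : ((Finset.univ.filter P).card : ℝ) ≤ 1 := by exact_mod_cast this
  nlinarith

open scoped Classical in
-- A neighbour lies on one side of `v` only, so it interferes with `a` or with `b` but not both.
-- Each slot is therefore charged once.
theorem sum_extra_le {B C : ℝ} (hB : 0 ≤ B) (hC : 0 ≤ C) (a b : Fin n) :
    ∑ x ∈ pairs n, (if x.1 = a ∧ InRight T v x.2 then extra T v σ a b B C x.2 else 0) +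
      ∑ x ∈ pairs n, (if x.2 = b ∧ InLeft T v x.1 then extra T v σ a b B C x.1 else 0) ≤
      B + C := by
  have hE := extra_nonneg (T := T) (v := v) (σ := σ) (a := a) (b := b) hB hC
  have h1 : ∑ x ∈ pairs n, (if x.1 = a ∧ InRight T v x.2 then extra T v σ a b B C x.2 else 0) ≤
      ∑ y : Fin n, if InRight T v y then extra T v σ a b B C y else 0 := by
    refine (Finset.sum_le_univ_sum_of_nonneg fun x => ?_).trans_eq ?_
    · split_ifs <;> simp [hE]
    · rw [Fintype.sum_prod_type_right]
      refine Finset.sum_congr rfl fun y _ => ?_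
      simp [ite_and]
  have h2 : ∑ x ∈ pairs n, (if x.2 = b ∧ InLeft T v x.1 then extra T v σ a b B C x.1 else 0) ≤
      ∑ y : Fin n, if InLeft T v y then extra T v σ a b B C y else 0 := by
    refine (Finset.sum_le_univ_sum_of_nonneg fun x => ?_).trans_eq ?_
    · split_ifs <;> simp [hE]
    · rw [Fintype.sum_prod_type]
      refine Finset.sum_congr rfl fun y _ => ?_
      simp [ite_and]
  refine (add_le_add h1 h2).trans ?_
  rw [← Finset.sum_add_distrib]
  refine (Finset.sum_le_sum (g := extra T v σ a b B C) fun y _ => ?_).trans ?_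
  · by_cases h : InLeft T v y
    · simp [h, h.not_inRight]
    · by_cases h' : InRight T v y <;> simp [h, h', hE]
  · unfold extra
    rw [Finset.sum_add_distrib]
    exact add_le_add (sum_ite_le_of_unique (fun _ _ => IsPred.eq) hB)
      (sum_ite_le_of_unique (fun _ _ => IsSucc.eq) hC)

theorem slotBefore_add_slotAfter_le (hC : IsContracting T p γ κ ρ) (hD : 0 ≤ D)
    (he : IsEdge T v σ a b) :
    slotBefore T γ κ D v σ a + slotAfter T γ κ D v σ a ≤
      (1 - ρ) * (D * edgeWeight T γ v σ a) := by
  have h0 := hC.gap _ _ he.numBefore_add_le (nodeSize_le n T v)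
  have := hC.base_pos v
  unfold slotBefore slotAfter edgeWeight slotWeight
  generalize numBefore (fun c => InLeft T v c) σ a = h at *
  generalize numBefore (fun c => InRight T v c) σ a = r at *
  have h2 : 0 ≤ D * (γ v ^ r * (γ v)⁻¹ ^ h) := by positivity
  have h3 := mul_le_mul_of_nonneg_left h0 h2
  push_cast at h3
  dsimp only
  linarith

theorem IsLip.treeChain_mulVec (hC : IsContracting T p γ κ ρ) (hF : IsLip T γ F D) (hD : 0 ≤ D) :
    IsLip T γ ((treeChain T p).mulVec F) (D * (1 - ρ / n.choose 2)) := by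
  classical
  intro v σ a b he
  have hab := fin_lt_of_inLeft_inRight hC.numLeaves he.left he.right
  have hmem : (a, b) ∈ pairs n := mem_pairs.2 hab
  have hN : 0 < (n.choose 2 : ℝ) := by
    rw [← card_pairs]
    exact_mod_cast Finset.card_pos.2 ⟨_, hmem⟩
  -- `matchPair` is an involution of the pairs, so the sum for the swapped state may be reindexed by
  -- it before comparing termwise.
  rw [LeagueHierarchy.treeChain_mulVec, LeagueHierarchy.treeChain_mulVec, ← mul_sub,
    ← sum_matchPair hC he fun x => heat T p F (swap a b * σ) x.1 x.2, abs_mul, abs_of_pos (by positivity)]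
  have h1 := (Finset.abs_sum_le_sum_abs _ _).trans
    (Finset.sum_le_sum fun x (hx : x ∈ pairs n) => abs_heat_sub_matchPair_le hC hF hD he hx)
  rw [Finset.sum_add_distrib, Finset.sum_add_distrib, Finset.sum_sub_distrib,
    Finset.sum_sub_distrib, Finset.sum_const,
    Finset.sum_ite_eq' (pairs n) (a, b), if_pos hmem, nsmul_eq_mul, card_pairs] at h1
  have h2 := sum_extra_le (T := T) (v := v) (σ := σ) (slotBefore_nonneg hC hD he)
    (slotAfter_nonneg hC hD he) a b
  have h3 := slotBefore_add_slotAfter_le hC hD he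
  rw [one_div, inv_mul_le_iff₀ hN]
  have h4 : (n.choose 2 : ℝ) * (D * (1 - ρ / n.choose 2) * edgeWeight T γ v σ a) =
      n.choose 2 * (D * edgeWeight T γ v σ a) - ρ * (D * edgeWeight T γ v σ a) := by
    field_simp
  rw [h4]
  linarith

end Pairs

/-! ### From the Lipschitz constant to the oscillation. -/

section Oscillation

variable {n : ℕ} {T : BinaryTree ℝ} {p : Fin n → Fin n → ℝ} {γ : List Bool → ℝ} {κ ρ : ℝ}
  {v : List Bool} {σ : Perm (Fin n)} {a b c d : Fin n} {F : Perm (Fin n) → ℝ} {D : ℝ}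

/-- The graph on the permutations whose edges are the steps of the chain. -/
def stepGraph (n : ℕ) (T : BinaryTree ℝ) : SimpleGraph (Perm (Fin n)) :=
  SimpleGraph.fromRel fun σ τ => ∃ v a b, IsEdge T v σ a b ∧ τ = swap a b * σ

theorem isEdge_of_adjacent (hT : T.numLeaves = n) (hab : a < b)
    (h : (σ.symm b : ℕ) = σ.symm a + 1) : IsEdge T (lca T a b) σ a b where
  left := inLeft_lca hab (hT ▸ b.2)
  right := inRight_lca hab (hT ▸ b.2)
  lt := Fin.lt_def.2 (by omega)
  clear c hc := by simp only [Fin.lt_def] at hc; omega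

theorem IsEdge.adj (he : IsEdge T v σ a b) : (stepGraph n T).Adj σ (swap a b * σ) := by
  rw [stepGraph, SimpleGraph.fromRel_adj]
  refine ⟨fun h => ?_, Or.inl ⟨v, a, b, he, rfl⟩⟩
  have h1 : swap a b = 1 := by simpa using h.symm
  have h2 : a = b := by simpa using h1
  subst h2
  exact he.left.not_inRight he.right

theorem stepGraph_adj_mul_swap (hT : T.numLeaves = n) (σ : Perm (Fin n)) {i j : Fin n}
    (hij : (j : ℕ) = i + 1) : (stepGraph n T).Adj σ (σ * swap i j) := by
  rw [mul_swap_eq_swap_mul]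
  have hne : σ i ≠ σ j := by
    intro h
    have := σ.injective h
    subst this
    omega
  rcases lt_or_gt_of_ne hne with h | h
  · exact (isEdge_of_adjacent hT h (by simpa using hij)).adj
  · have h1 := (isEdge_of_adjacent (σ := swap (σ i) (σ j) * σ) hT h
      (by simpa [swap_mul_symm_apply] using hij)).adj.symm
    rwa [swap_comm (σ j), swap_swap_mul] at h1

/-- Elements in adjacent positions have nothing between them, hence are always movable, and adjacent
transpositions generate the symmetric group. -/
theorem stepGraph_preconnected (hT : T.numLeaves = n) : (stepGraph n T).Preconnected := by
  cases n with
  | zero => intro σ τ; rw [Subsingleton.elim σ τ]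
  | succ k =>
    have key : ∀ g : Perm (Fin (k + 1)), ∀ σ, (stepGraph (k + 1) T).Reachable σ (σ * g) := by
      intro g
      have hg : g ∈ Submonoid.closure (Set.range fun i : Fin k => swap i.castSucc i.succ) := by
        rw [Equiv.Perm.mclosure_swap_castSucc_succ]; trivial
      induction hg using Submonoid.closure_induction with
      | mem x hx =>
        obtain ⟨i, rfl⟩ := hx
        exact fun σ => (stepGraph_adj_mul_swap hT σ (by simp)).reachable
      | one => intro σ; simp
      | mul x y _ _ hx hy =>
        intro σ
        rw [← mul_assoc]
        exact (hx σ).trans (hy _)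
    intro σ τ
    simpa using key (σ⁻¹ * τ) σ

theorem abs_sub_le_of_adj {V : Type*} {G : SimpleGraph V} {f : V → ℝ} {B : ℝ}
    (h : ∀ x y, G.Adj x y → |f x - f y| ≤ B) {x y : V} (w : G.Walk x y) :
    |f x - f y| ≤ w.length * B := by
  induction w with
  | nil => simp
  | cons hadj w ih =>
    have h1 := h _ _ hadj
    rw [SimpleGraph.Walk.length_cons]
    push_cast
    have := abs_sub_le (f _) (f _) (f _) |>.trans (add_le_add h1 ih)
    linarith

theorem IsLip.abs_sub_le (hT : T.numLeaves = n) (hF : IsLip T γ F D) (hD : 0 ≤ D) {W : ℝ}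
    (hW0 : 0 ≤ W) (hW : ∀ v (σ : Perm (Fin n)) a b, IsEdge T v σ a b → edgeWeight T γ v σ a ≤ W)
    (σ τ : Perm (Fin n)) : |F σ - F τ| ≤ n.factorial * (D * W) := by
  classical
  -- A path repeats no vertex, so it has fewer than n! edges. This crude count suffices, since only
  -- its logarithm enters the mixing time.
  obtain ⟨w, hw⟩ := (stepGraph_preconnected hT σ τ).exists_isPath
  have h1 := hw.length_lt
  rw [Fintype.card_perm, Fintype.card_fin] at h1
  have h2 : |F σ - F τ| ≤ w.length * (D * W) := by
    refine abs_sub_le_of_adj (fun x y hxy => ?_) w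
    rw [stepGraph, SimpleGraph.fromRel_adj] at hxy
    rcases hxy.2 with ⟨v, a, b, he, rfl⟩ | ⟨v, a, b, he, rfl⟩
    · exact (hF _ _ _ _ he).trans (mul_le_mul_of_nonneg_left (hW _ _ _ _ he) hD)
    · rw [abs_sub_comm]
      exact (hF _ _ _ _ he).trans (mul_le_mul_of_nonneg_left (hW _ _ _ _ he) hD)
  refine h2.trans (mul_le_mul_of_nonneg_right ?_ (by positivity))
  exact_mod_cast h1.le

theorem edgeWeight_le (hγ1 : 1 ≤ γ v) (hγ3 : γ v ≤ 3) (he : IsEdge T v σ a b) :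
    edgeWeight T γ v σ a ≤ 3 ^ n * (n : ℝ) ^ 2 := by
  have h1 := he.numBefore_add_le
  have h2 := nodeSize_le n T v
  unfold edgeWeight slotWeight
  generalize numBefore (fun c => InLeft T v c) σ a = h at *
  generalize numBefore (fun c => InRight T v c) σ a = r at *
  generalize nodeSize n T v = m at *
  have h1' : (h : ℝ) + r + 2 ≤ m := by exact_mod_cast h1
  have h2' : (m : ℝ) ≤ n := by exact_mod_cast h2
  have hh : (0 : ℝ) ≤ h := Nat.cast_nonneg _
  have hr : (0 : ℝ) ≤ r := Nat.cast_nonneg _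
  have e1 : γ v ^ r ≤ 3 ^ n :=
    (pow_le_pow_left₀ (by linarith) hγ3 r).trans (pow_le_pow_right₀ (by norm_num) (by omega))
  have e2 : (γ v)⁻¹ ^ h ≤ 1 := pow_le_one₀ (by positivity) (inv_le_one_of_one_le₀ hγ1)
  have e3 : γ v ^ r * (γ v)⁻¹ ^ h ≤ 3 ^ n := by
    calc γ v ^ r * (γ v)⁻¹ ^ h ≤ 3 ^ n * 1 := by gcongr
      _ = 3 ^ n := mul_one _
  refine mul_le_mul e3 ?_ (mul_nonneg (by positivity) (by linarith)) (by positivity)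
  rw [sq]
  exact mul_le_mul (by linarith) (by linarith) (by linarith) (by linarith)

theorem le_edgeWeight (hγ1 : 1 ≤ γ v) (hγ3 : γ v ≤ 3) (he : IsEdge T v σ a b) :
    (3 ^ n)⁻¹ ≤ edgeWeight T γ v σ a := by
  have h1 := he.numBefore_add_le
  have h2 := nodeSize_le n T v
  unfold edgeWeight slotWeight
  generalize numBefore (fun c => InLeft T v c) σ a = h at *
  generalize numBefore (fun c => InRight T v c) σ a = r at *
  generalize nodeSize n T v = m at *
  have h1' : (h : ℝ) + r + 2 ≤ m := by exact_mod_cast h1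
  have hh : (0 : ℝ) ≤ h := Nat.cast_nonneg _
  have hr : (0 : ℝ) ≤ r := Nat.cast_nonneg _
  have e1 : 1 ≤ γ v ^ r := one_le_pow₀ hγ1
  have e2 : (3 ^ n : ℝ)⁻¹ ≤ (γ v)⁻¹ ^ h := by
    rw [inv_pow]
    refine inv_anti₀ (by positivity) ?_
    exact (pow_le_pow_left₀ (by linarith) hγ3 h).trans
      (pow_le_pow_right₀ (by norm_num) (by omega))
  have e3 : 1 ≤ ((h : ℝ) + r + 1) * (m - 1 - (h + r)) :=
    one_le_mul_of_one_le_of_one_le (by linarith) (by linarith)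
  have e4 : 0 ≤ (3 ^ n : ℝ)⁻¹ := by positivity
  have e5 : (3 ^ n : ℝ)⁻¹ ≤ γ v ^ r * (γ v)⁻¹ ^ h := by nlinarith
  nlinarith

theorem isLip_of_abs_le_one (hγ1 : ∀ v, 1 ≤ γ v) (hγ3 : ∀ v, γ v ≤ 3) (hF : ∀ σ, |F σ| ≤ 1) :
    IsLip T γ F (2 * 3 ^ n) := by
  intro v σ a b he
  have h1 := le_edgeWeight (hγ1 v) (hγ3 v) he
  have h2 := abs_sub (F σ) (F (swap a b * σ))
  have h3 := hF σ
  have h4 := hF (swap a b * σ)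
  calc |F σ - F (swap a b * σ)| ≤ 2 * 3 ^ n * (3 ^ n)⁻¹ := by
        rw [mul_assoc, mul_inv_cancel₀ (by positivity)]; linarith
    _ ≤ _ := by gcongr

theorem IsLip.pow_mulVec (hC : IsContracting T p γ κ ρ) (hF : IsLip T γ F D) (hD : 0 ≤ D)
    (hθ : 0 ≤ 1 - ρ / n.choose 2) (t : ℕ) :
    IsLip T γ ((treeChain T p ^ t).mulVec F) (D * (1 - ρ / n.choose 2) ^ t) := by
  induction t with
  | zero => simpa using hF
  | succ t ih =>
    rw [pow_succ', ← Matrix.mulVec_mulVec, pow_succ, ← mul_assoc]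
    exact ih.treeChain_mulVec hC (by positivity)

end Oscillation

/-! ### Total variation through test functions. -/

section TotalVariation

variable {Ω : Type*} [Fintype Ω] [DecidableEq Ω] {M : Matrix Ω Ω ℝ} {π : Ω → ℝ}

theorem IsStationary.pow (h : IsStationary M π) (t : ℕ) : Matrix.vecMul π (M ^ t) = π := by
  induction t with
  | zero => simp
  | succ t ih => rw [pow_succ, ← Matrix.vecMul_vecMul, ih, h.2]

/-- Total variation is controlled by the oscillation of the images of bounded functions. -/
theorem IsStationary.tvDist_le [Nonempty Ω] (h : IsStationary M π) (t : ℕ) {B : ℝ}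
    (hB : ∀ f : Ω → ℝ, (∀ x, |f x| ≤ 1) →
      ∀ x y, |(M ^ t).mulVec f x - (M ^ t).mulVec f y| ≤ 2 * B) : tvDist M π t ≤ B := by
  refine ciSup_le fun x => ?_
  -- The sign function attains the l¹ norm as a difference of two expectations; stationarity turns
  -- the one under `π` into an average of the values of `(M ^ t).mulVec f`.
  let f : Ω → ℝ := fun y => SignType.sign ((M ^ t) x y - π y)
  have hf : ∀ y, |f y| ≤ 1 := by
    intro y
    simp only [f]
    rcases lt_trichotomy ((M ^ t) x y - π y) 0 with h | h | h <;> simp [h]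
  have h1 : ∑ y, |(M ^ t) x y - π y| = (M ^ t).mulVec f x - π ⬝ᵥ f := by
    simp only [Matrix.mulVec, dotProduct, ← Finset.sum_sub_distrib]
    refine Finset.sum_congr rfl fun y _ => ?_
    rw [← sub_mul]
    exact (self_mul_sign _).symm
  have h2 : π ⬝ᵥ f = π ⬝ᵥ (M ^ t).mulVec f := by
    rw [Matrix.dotProduct_mulVec, h.pow]
  have h3 : (M ^ t).mulVec f x - π ⬝ᵥ f =
      ∑ z, π z * ((M ^ t).mulVec f x - (M ^ t).mulVec f z) := by
    rw [h2]
    simp only [mul_sub, Finset.sum_sub_distrib, ← Finset.sum_mul, h.1.2, one_mul]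
    rfl
  have h4 : ∑ z, π z * ((M ^ t).mulVec f x - (M ^ t).mulVec f z) ≤ ∑ z, π z * (2 * B) :=
    Finset.sum_le_sum fun z _ => mul_le_mul_of_nonneg_left
      ((le_abs_self _).trans (hB f hf x z)) (h.1.1 z)
  rw [← Finset.sum_mul, h.1.2, one_mul] at h4
  linarith

end TotalVariation

/-! ### Geometric decay of the total variation distance. -/

section Bound

variable {n : ℕ} {T : BinaryTree ℝ} {p : Fin n → Fin n → ℝ} {γ : List Bool → ℝ} {κ ρ : ℝ}

theorem tvDist_treeChain_le (hC : IsContracting T p γ κ ρ)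
    (hS : IsStationary (treeChain T p) (permDist p)) (hγ1 : ∀ v, 1 ≤ γ v) (hγ3 : ∀ v, γ v ≤ 3)
    (hθ : 0 ≤ 1 - ρ / n.choose 2) (t : ℕ) :
    tvDist (treeChain T p) (permDist p) t ≤
      n.factorial * 9 ^ n * (n : ℝ) ^ 2 * (1 - ρ / n.choose 2) ^ t := by
  refine hS.tvDist_le t fun f hf σ τ => ?_
  have h1 := (isLip_of_abs_le_one (T := T) hγ1 hγ3 hf).pow_mulVec hC (by positivity) hθ t
  have h2 := h1.abs_sub_le hC.numLeaves (by positivity) (W := 3 ^ n * (n : ℝ) ^ 2)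
    (by positivity) (fun v σ a b he => edgeWeight_le (hγ1 v) (hγ3 v) he) σ τ
  refine h2.trans_eq ?_
  rw [show (9 : ℝ) = 3 * 3 by norm_num, mul_pow]
  ring

end Bound

/-! ### Detailed balance and stationarity. -/

section Stationary

variable {n : ℕ} {T : BinaryTree ℝ} {p : Fin n → Fin n → ℝ} {σ : Perm (Fin n)} {a b c : Fin n}
  {F : Perm (Fin n) → ℝ}

theorem HasLeagueStructure.congr (hp : HasLeagueStructure p T) {a b c d : Fin n} (hab : a < b)
    (hcd : c < d) (h : lca T a b = lca T c d) : p a b = p c d := by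
  have h1 := (hp a b hab).1
  rw [h, (hp c d hcd).1] at h1
  exact (Option.some_injective _ h1).symm

/-- Leaves outside the subtree of `lca a b` do not distinguish `a` from `b`. -/
theorem HasLeagueStructure.eq_of_not_isDescendant (hT : T.numLeaves = n)
    (hp : HasLeagueStructure p T) (hab : a < b) (hc : ¬ IsDescendant T c (lca T a b)) :
    p a c = p b c ∧ p c a = p c b := by
  have lt : ∀ x : Fin n, (x : ℕ) < T.numLeaves := fun x => hT ▸ x.2
  have ha : IsDescendant T a (lca T a b) := (inLeft_lca hab (lt b)).isDescendant
  have hb : IsDescendant T b (lca T a b) := (inRight_lca hab (lt b)).isDescendant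
  have hca : c ≠ a := by rintro rfl; exact hc ha
  have below : ∀ u, IsDescendant T a u → IsDescendant T c u →
      (InLeft T u a ↔ InLeft T u b) ∧ (InRight T u a ↔ InRight T u b) := by
    intro u h1 h2
    rcases List.prefix_or_prefix_of_prefix h1 ha with h | h
    · rcases eq_or_append_prefix h with rfl | ⟨x, h⟩
      · exact absurd h2 hc
      · exact same_side h ha hb
    · exact absurd (isDescendant_of_prefix h h2) hc
  have key : p a c = p b c := by
    rcases lt_or_gt_of_ne hca with h | h
    · have h1 := inLeft_lca h (lt a)
      have h2 := inRight_lca h (lt a)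
      have h3 := (below _ h2.isDescendant h1.isDescendant).2.1 h2
      have h4 := fin_lt_of_inLeft_inRight hT h1 h3
      rw [(hp _ _ h).2, (hp _ _ h4).2, hp.congr h h4 (lca_eq h1 h3).symm]
    · have h1 := inLeft_lca h (lt c)
      have h2 := inRight_lca h (lt c)
      have h3 := (below _ h1.isDescendant h2.isDescendant).1.1 h1
      exact hp.congr h (fin_lt_of_inLeft_inRight hT h3 h2) (lca_eq h3 h2).symm
  have hcb : c ≠ b := by rintro rfl; exact hc hb
  have flip : ∀ x y : Fin n, x ≠ y → p x y = 1 - p y x := by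
    intro x y hxy
    rcases lt_or_gt_of_ne hxy with h | h
    · rw [(hp _ _ h).2]; ring
    · exact (hp _ _ h).2
  exact ⟨key, by rw [flip c a hca, flip c b hcb, key]⟩

/-- Products over pairs, when two positions are exchanged that no position in between
distinguishes. -/
theorem mul_prod_pairs_swap (P : Fin n → Fin n → ℝ) {i j : Fin n} (hij : i < j)
    (h : ∀ k, i < k → k < j → P i k = P j k ∧ P k i = P k j) :
    P j i * ∏ x ∈ pairs n, P x.1 x.2 =
      P i j * ∏ x ∈ pairs n, P (swap i j x.1) (swap i j x.2) := by
  -- `φ` follows the exchange where it keeps a pair ordered and fixes the other pairs. The fixed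
  -- ones that get reversed are (i, j) and the pairs of i or j with a position in between; the
  -- former gives the two outer factors, the latter are covered by `h`.
  let φ : Fin n × Fin n → Fin n × Fin n := fun x =>
    if swap i j x.1 < swap i j x.2 then (swap i j x.1, swap i j x.2) else x
  have hφ : ∀ x ∈ pairs n, φ x ∈ pairs n ∧ φ (φ x) = x := by
    intro x hx
    by_cases hlt : swap i j x.1 < swap i j x.2
    · have e : φ x = (swap i j x.1, swap i j x.2) := if_pos hlt
      rw [e]
      refine ⟨mem_pairs.2 hlt, ?_⟩
      have hx' := mem_pairs.1 hx
      simp [φ, hx']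
    · have e : φ x = x := if_neg hlt
      rw [e, e]
      exact ⟨hx, rfl⟩
  have hsum : ∏ x ∈ pairs n, P (swap i j x.1) (swap i j x.2) =
      ∏ x ∈ pairs n, P (swap i j (φ x).1) (swap i j (φ x).2) :=
    (Finset.prod_nbij' φ φ (fun x hx => (hφ x hx).1) (fun x hx => (hφ x hx).1)
      (fun x hx => (hφ x hx).2) (fun x hx => (hφ x hx).2) fun _ _ => rfl).symm
  have hmem : (i, j) ∈ pairs n := mem_pairs.2 hij
  have hself : φ (i, j) = (i, j) := by simp [φ, not_lt.2 hij.le]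
  rw [hsum, ← Finset.mul_prod_erase _ _ hmem, ← Finset.mul_prod_erase (pairs n) (fun x =>
    P (swap i j (φ x).1) (swap i j (φ x).2)) hmem, hself]
  simp only [swap_apply_left, swap_apply_right]
  rw [← mul_assoc, ← mul_assoc, mul_comm (P j i)]
  congr 1
  refine Finset.prod_congr rfl fun x hx => ?_
  obtain ⟨k, l⟩ := x
  rw [Finset.mem_erase, mem_pairs] at hx
  obtain ⟨hne, hkl⟩ := hx
  by_cases hlt : swap i j k < swap i j l
  · simp [φ, hlt]
  · have e : φ (k, l) = (k, l) := if_neg hlt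
    rw [e]
    dsimp only at hkl ⊢
    by_cases hki : k = i
    · subst hki
      have hlj : l ≠ j := by rintro rfl; exact hne rfl
      rw [swap_apply_left, swap_apply_of_ne_of_ne hkl.ne' hlj] at hlt ⊢
      exact (h l hkl (lt_of_le_of_ne (not_lt.1 hlt) hlj)).1
    · by_cases hlj : l = j
      · subst hlj
        rw [swap_apply_right, swap_apply_of_ne_of_ne hki hkl.ne] at hlt ⊢
        exact (h k (lt_of_le_of_ne (not_lt.1 hlt) (Ne.symm hki)) hkl).2.symm
      · exfalso
        apply hlt
        by_cases hkj : k = j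
        · subst hkj
          rw [swap_apply_right, swap_apply_of_ne_of_ne (hij.trans hkl).ne' hkl.ne']
          exact hij.trans hkl
        · by_cases hli : l = i
          · subst hli
            rw [swap_apply_left, swap_apply_of_ne_of_ne hki hkj]
            exact hkl.trans hij
          · rwa [swap_apply_of_ne_of_ne hki hkj, swap_apply_of_ne_of_ne hli hlj]

theorem prod_pairs (f : Fin n → Fin n → ℝ) :
    ∏ a : Fin n, ∏ b ∈ Finset.Ioi a, f a b = ∏ x ∈ pairs n, f x.1 x.2 := by
  rw [pairs, Finset.prod_filter, Fintype.prod_prod_type]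
  refine Finset.prod_congr rfl fun a _ => ?_
  rw [← Finset.prod_filter]
  refine Finset.prod_congr ?_ fun _ _ => rfl
  ext b
  simp

theorem mul_weight_eq (hT : T.numLeaves = n) (hp : HasLeagueStructure p T) (hab : a < b)
    (hlt : σ.symm a < σ.symm b) (hM : Movable T σ a b) :
    p b a * weight p σ = p a b * weight p (swap a b * σ) := by
  have h := mul_prod_pairs_swap (fun i j => p (σ i) (σ j)) hlt fun k h1 h2 => by
    have := hp.eq_of_not_isDescendant hT hab (hM (σ k) (Or.inl ⟨by simpa using h1,
      by simpa using h2⟩))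
    simpa using this
  have key : ∀ k, σ (swap (σ.symm a) (σ.symm b) k) = (swap a b * σ) k := by
    intro k
    have := DFunLike.congr_fun (mul_swap_eq_swap_mul σ (σ.symm a) (σ.symm b)) k
    simpa using this
  simp only [key, apply_symm_apply] at h
  rw [weight, weight, prod_pairs, prod_pairs]
  exact h

/-- By detailed balance the changes at `σ` and at `swap a b * σ` cancel, for each choice of pair
separately. -/
theorem sum_weight_mul_heat (hT : T.numLeaves = n) (hp : HasLeagueStructure p T) (hab : a < b)
    (F : Perm (Fin n) → ℝ) :
    ∑ σ, weight p σ * heat T p F σ a b = ∑ σ, weight p σ * F σ := by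
  have hba := (hp a b hab).2
  have hm : ∀ σ : Perm (Fin n), Movable T (swap a b * σ) a b ↔ Movable T σ a b := fun σ =>
    clear_swap_mul (S := fun c : Fin n => IsDescendant T c (lca T a b))
  have key : ∀ σ : Perm (Fin n), σ.symm a < σ.symm b →
      weight p σ * (heat T p F σ a b - F σ) + weight p (swap a b * σ) *
        (heat T p F (swap a b * σ) a b - F (swap a b * σ)) = 0 := by
    intro σ hlt
    by_cases hM : Movable T σ a b
    · have hlt' : (swap a b * σ).symm b < (swap a b * σ).symm a := by
        simpa [swap_mul_symm_apply] using hlt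
      rw [heat_sub_of_lt hM hlt, heat_sub_of_gt ((hm σ).2 hM) hlt', swap_swap_mul]
      have h1 := mul_weight_eq hT hp hab hlt hM
      rw [hba] at h1
      linear_combination (-(F σ - F (swap a b * σ))) * h1
    · rw [heat_of_not_movable hM, heat_of_not_movable (mt (hm σ).1 hM)]
      ring
  have key' : ∀ σ : Perm (Fin n),
      weight p σ * (heat T p F σ a b - F σ) + weight p (swap a b * σ) *
        (heat T p F (swap a b * σ) a b - F (swap a b * σ)) = 0 := by
    intro σ
    have hne : σ.symm a ≠ σ.symm b := by simpa using hab.ne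
    rcases lt_or_gt_of_ne hne with h | h
    · exact key σ h
    · have := key (swap a b * σ) (by simpa [swap_mul_symm_apply] using h)
      rw [swap_swap_mul] at this
      rw [add_comm]
      exact this
  have h1 : ∑ σ, weight p σ * (heat T p F σ a b - F σ) =
      ∑ σ, weight p (swap a b * σ) * (heat T p F (swap a b * σ) a b - F (swap a b * σ)) :=
    (Equiv.sum_comp (Equiv.mulLeft (swap a b)) fun σ =>
      weight p σ * (heat T p F σ a b - F σ)).symm
  have h2 := Finset.sum_congr rfl fun (σ : Perm (Fin n)) (_ : σ ∈ Finset.univ) => key' σ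
  rw [Finset.sum_add_distrib, ← h1, Finset.sum_const_zero] at h2
  simp only [mul_sub, Finset.sum_sub_distrib] at h2
  linarith

theorem weight_nonneg (h0 : ∀ a b : Fin n, a ≠ b → 0 ≤ p a b) (σ : Perm (Fin n)) :
    0 ≤ weight p σ :=
  Finset.prod_nonneg fun _ _ => Finset.prod_nonneg fun _ hj =>
    h0 _ _ (σ.injective.ne (Finset.mem_Ioi.1 hj).ne)

theorem sum_weight_pos (h0 : ∀ a b : Fin n, a ≠ b → 0 ≤ p a b)
    (h1 : ∀ a b : Fin n, a < b → 0 < p a b) : 0 < ∑ σ, weight p σ := by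
  refine Finset.sum_pos' (fun σ _ => weight_nonneg h0 σ) ⟨1, Finset.mem_univ _, ?_⟩
  exact Finset.prod_pos fun _ _ => Finset.prod_pos fun _ hj => h1 _ _ (Finset.mem_Ioi.1 hj)

theorem isStationary_permDist (hn : 2 ≤ n) (hT : T.numLeaves = n) (hp : HasLeagueStructure p T)
    (h0 : ∀ a b : Fin n, a ≠ b → 0 ≤ p a b) (h1 : ∀ a b : Fin n, a < b → 0 < p a b) :
    IsStationary (treeChain T p) (permDist p) := by
  have hZ := sum_weight_pos h0 h1
  refine ⟨⟨fun σ => div_nonneg (weight_nonneg h0 σ) hZ.le, ?_⟩, ?_⟩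
  · simp only [permDist]
    rw [← Finset.sum_div, div_self hZ.ne']
  · have key : ∀ F : Perm (Fin n) → ℝ,
        permDist p ⬝ᵥ (treeChain T p).mulVec F = permDist p ⬝ᵥ F := by
      intro F
      have hN : (n.choose 2 : ℝ) ≠ 0 := by exact_mod_cast (Nat.choose_pos hn).ne'
      simp only [dotProduct, permDist, div_mul_eq_mul_div, ← Finset.sum_div, treeChain_mulVec,
        one_mul, mul_div_assoc']
      simp only [Finset.mul_sum]
      rw [Finset.sum_comm]
      rw [Finset.sum_congr rfl fun x (hx : x ∈ pairs n) =>
        sum_weight_mul_heat hT hp (mem_pairs.1 hx) F, Finset.sum_const, card_pairs, nsmul_eq_mul]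
      field_simp
    ext τ
    have h := key (Pi.single τ 1)
    rw [Matrix.dotProduct_mulVec] at h
    simpa using h

end Stationary

/-! ### Choice of parameters and the mixing times. -/

section MixingTime

variable {n : ℕ} {T : BinaryTree ℝ} {p : Fin n → Fin n → ℝ} {x ρ ε : ℝ}

/-- The bases of the edge weights. -/
noncomputable def nodeBase (T : BinaryTree ℝ) (x : ℝ) (v : List Bool) : ℝ :=
  (labelAt T v).getD 1 * (2 + x)

theorem nodeBase_mem (hT : IsLeagueTree n T) (hx0 : 0 ≤ x) (hx1 : x ≤ 1) (v : List Bool) :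
    1 ≤ nodeBase T x v ∧ nodeBase T x v ≤ 3 := by
  unfold nodeBase
  cases h : labelAt T v with
  -- No edge exists at an address without a label; the default 1 only keeps the bounds uniform.
  | none =>
    simp only [Option.getD_none]
    constructor <;> linarith
  | some q =>
    obtain ⟨h1, h2⟩ := hT.2 v q h
    simp only [Option.getD_some]
    constructor <;> nlinarith

/-- Here κ = 1/(2+x) and γ = q(2+x), so that q = κγ exactly. The parameter x measures the bias of
the labels: 4q(1-q) ≤ 1-x. -/
theorem isContracting (hT : IsLeagueTree n T) (hp : HasLeagueStructure p T) (hx0 : 0 ≤ x)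
    (hx1 : x ≤ 1) (hpx : ∀ a b : Fin n, a < b → 4 * (p a b * (1 - p a b)) ≤ 1 - x)
    (hρ : ∀ P : ℝ, 0 ≤ P → 4 * P ≤ (n : ℝ) ^ 2 → (2 + x)⁻¹ * (2 * P - 2) ≤ (1 - ρ) * P) :
    IsContracting T p (nodeBase T x) (2 + x)⁻¹ ρ where
  numLeaves := hT.1
  congr a b c d hab hcd h := hp.congr hab hcd h
  nonneg a b hab := by linarith [(hT.2 _ _ (hp a b hab).1).1]
  le_one a b hab := (hT.2 _ _ (hp a b hab).1).2
  base_pos v := by linarith [(nodeBase_mem hT hx0 hx1 v).1]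
  le_mul a b hab := by
    rw [nodeBase, (hp a b hab).1, Option.getD_some]
    field_simp
    exact le_rfl
  mul_le a b hab := by
    rw [nodeBase, (hp a b hab).1, Option.getD_some, ← one_div, le_div_iff₀ (by linarith)]
    -- The claim is q(1-q)(2+x)² ≤ 1, and (1-x)(2+x)² = 4 - 3x² - x³ ≤ 4.
    nlinarith [mul_le_mul_of_nonneg_right (hpx a b hab) (sq_nonneg (2 + x)), pow_nonneg hx0 3,
      sq_nonneg x]
  rate_nonneg := by positivity
  gap m j hj hm := by
    have h1 : (j : ℝ) + 2 ≤ m := by exact_mod_cast hj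
    have h2 : (m : ℝ) ≤ n := by exact_mod_cast hm
    have h3 : (0 : ℝ) ≤ j := Nat.cast_nonneg _
    have h4 : (m : ℝ) ^ 2 ≤ (n : ℝ) ^ 2 := by gcongr
    -- The two neighbouring quadratic values add up to 2P-2, and 4P ≤ m² by the arithmetic-geometric
    -- mean inequality.
    have h := hρ ((j + 1) * (m - 1 - j)) (mul_nonneg (by linarith) (by linarith))
      (by nlinarith [sq_nonneg ((m : ℝ) - 2 - 2 * j)])
    convert h using 2
    ring

/-- The constant is 6 = 1 + 4 + 1, from n! ≤ n^n, 9^n ≤ n^(4n) and n² ≤ n^n. -/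
theorem log_bound (hn : 2 ≤ n) (hε : 0 < ε) (hε1 : ε ≤ 1) :
    Real.log (n.factorial * 9 ^ n * (n : ℝ) ^ 2 / ε) ≤ 6 * n * Real.log (n / ε) := by
  have hn' : (2 : ℝ) ≤ n := by exact_mod_cast hn
  have hf : 0 < (n.factorial : ℝ) := by exact_mod_cast n.factorial_pos
  have h1 : (n.factorial : ℝ) ≤ (n : ℝ) ^ n := by exact_mod_cast n.factorial_le_pow
  have h9 : (9 : ℝ) ≤ (n : ℝ) ^ 4 := by
    have : (2 : ℝ) ^ 4 ≤ (n : ℝ) ^ 4 := by gcongr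
    linarith
  have h2 : (9 : ℝ) ^ n ≤ ((n : ℝ) ^ 4) ^ n := by gcongr
  have h3 : (n : ℝ) ^ 2 ≤ (n : ℝ) ^ n := pow_le_pow_right₀ (by linarith) hn
  have h4 : (n.factorial * 9 ^ n * (n : ℝ) ^ 2 : ℝ) ≤ (n : ℝ) ^ (6 * n) := by
    calc (n.factorial * 9 ^ n * (n : ℝ) ^ 2 : ℝ) ≤ (n : ℝ) ^ n * ((n : ℝ) ^ 4) ^ n * (n : ℝ) ^ n := by
          gcongr
      _ = (n : ℝ) ^ (6 * n) := by ring
  have h5 : Real.log (n.factorial * 9 ^ n * (n : ℝ) ^ 2) ≤ 6 * n * Real.log n := by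
    refine (Real.log_le_log (by positivity) h4).trans_eq ?_
    rw [Real.log_pow]
    push_cast
    ring
  have h6 : Real.log ε ≤ 0 := Real.log_nonpos hε.le hε1
  rw [Real.log_div (by positivity) hε.ne', Real.log_div (by positivity) hε.ne']
  nlinarith

theorem exists_isMixingTime (hn : 2 ≤ n) (hT : IsLeagueTree n T) (hp : HasLeagueStructure p T)
    (hx0 : 0 ≤ x) (hx1 : x ≤ 1)
    (hpx : ∀ a b : Fin n, a < b → 4 * (p a b * (1 - p a b)) ≤ 1 - x)
    (hρ0 : 0 < ρ) (hρ1 : ρ ≤ 1)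
    (hρ : ∀ P : ℝ, 0 ≤ P → 4 * P ≤ (n : ℝ) ^ 2 → (2 + x)⁻¹ * (2 * P - 2) ≤ (1 - ρ) * P)
    (hε : 0 < ε) (hε1 : ε ≤ 1) :
    ∃ τ : ℕ, IsMixingTime (treeChain T p) (permDist p) ε τ ∧
      (τ : ℝ) ≤ 3 * (n : ℝ) ^ 3 / ρ * Real.log (n / ε) + 1 := by
  have hn' : (2 : ℝ) ≤ n := by exact_mod_cast hn
  have hC := isContracting hT hp hx0 hx1 hpx hρ
  have h0 : ∀ a b : Fin n, a ≠ b → 0 ≤ p a b := by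
    intro a b hab
    rcases lt_or_gt_of_ne hab with h | h
    · exact hC.nonneg a b h
    · rw [(hp b a h).2, sub_nonneg]
      exact hC.le_one b a h
  have hS := isStationary_permDist hn hT.1 hp h0 fun a b hab => by
    linarith [(hT.2 _ _ (hp a b hab).1).1]
  have hN1 : (1 : ℝ) ≤ n.choose 2 := by exact_mod_cast Nat.choose_pos hn
  have hN2 : (n.choose 2 : ℝ) ≤ (n : ℝ) ^ 2 / 2 := by
    rw [Nat.cast_choose_two]
    nlinarith
  have hθ : 0 ≤ 1 - ρ / n.choose 2 := by
    rw [sub_nonneg, div_le_one (by linarith)]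
    linarith
  have hf : 0 < (n.factorial : ℝ) := by exact_mod_cast n.factorial_pos
  set A : ℝ := n.factorial * 9 ^ n * (n : ℝ) ^ 2 with hA
  have hA0 : 0 < A := by positivity
  set t₀ : ℕ := ⌈n.choose 2 / ρ * Real.log (A / ε)⌉₊ with ht₀
  have hmem : t₀ ∈ {t : ℕ | ∀ t' : ℕ, t ≤ t' →
      tvDist (treeChain T p) (permDist p) t' ≤ ε} := by
    intro t ht
    refine (tvDist_treeChain_le hC hS (fun v => (nodeBase_mem hT hx0 hx1 v).1)
      (fun v => (nodeBase_mem hT hx0 hx1 v).2) hθ t).trans ?_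
    have h1 : n.choose 2 / ρ * Real.log (A / ε) ≤ t :=
      (Nat.le_ceil _).trans (by exact_mod_cast ht)
    have h2 : Real.log (A / ε) ≤ ρ / n.choose 2 * t := by
      calc Real.log (A / ε) = ρ / n.choose 2 * (n.choose 2 / ρ * Real.log (A / ε)) := by
            field_simp
        _ ≤ ρ / n.choose 2 * t := by gcongr
    have h3 : (1 - ρ / n.choose 2) ^ t ≤ Real.exp (-(ρ / n.choose 2 * t)) := by
      calc (1 - ρ / n.choose 2) ^ t ≤ Real.exp (-(ρ / n.choose 2)) ^ t := by
            gcongr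
            exact Real.one_sub_le_exp_neg _
        _ = Real.exp (-(ρ / n.choose 2 * t)) := by
            rw [← Real.exp_nat_mul]
            ring_nf
    have h4 : Real.exp (-(ρ / n.choose 2 * t)) ≤ ε / A := by
      calc Real.exp (-(ρ / n.choose 2 * t)) ≤ Real.exp (-Real.log (A / ε)) :=
            Real.exp_le_exp.2 (by linarith)
        _ = ε / A := by rw [Real.exp_neg, Real.exp_log (by positivity), inv_div]
    calc A * (1 - ρ / n.choose 2) ^ t ≤ A * (ε / A) := by gcongr; exact h3.trans h4
      _ = ε := by field_simp
  classical
  have hex : ∃ t, t ∈ {t : ℕ | ∀ t' : ℕ, t ≤ t' →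
      tvDist (treeChain T p) (permDist p) t' ≤ ε} := ⟨t₀, hmem⟩
  refine ⟨Nat.find hex, ⟨hS, Nat.find_spec hex, fun t ht => Nat.find_min' hex ht⟩, ?_⟩
  have h5 : (Nat.find hex : ℝ) ≤ t₀ := by exact_mod_cast Nat.find_min' hex hmem
  have hL : 0 ≤ Real.log (n / ε) := Real.log_nonneg (by rw [le_div_iff₀ hε]; linarith)
  have hlog : Real.log (A / ε) ≤ 6 * n * Real.log (n / ε) := log_bound hn hε hε1
  have h6 : n.choose 2 / ρ * Real.log (A / ε) ≤ 3 * (n : ℝ) ^ 3 / ρ * Real.log (n / ε) := by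
    calc n.choose 2 / ρ * Real.log (A / ε) ≤ n.choose 2 / ρ * (6 * n * Real.log (n / ε)) := by
          gcongr
      _ ≤ (n : ℝ) ^ 2 / 2 / ρ * (6 * n * Real.log (n / ε)) := by gcongr
      _ = 3 * (n : ℝ) ^ 3 / ρ * Real.log (n / ε) := by ring
  have h7 : (t₀ : ℝ) ≤ 3 * (n : ℝ) ^ 3 / ρ * Real.log (n / ε) + 1 := by
    rw [ht₀]
    refine (Nat.ceil_le_ceil h6 |> Nat.cast_le.2).trans (Nat.ceil_lt_add_one (by positivity)).le
  linarith

theorem half_le_log (hn : 2 ≤ n) (hε : 0 < ε) (hε1 : ε ≤ 1) : 1 / 2 ≤ Real.log (n / ε) := by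
  have hn' : (2 : ℝ) ≤ n := by exact_mod_cast hn
  have h1 : (2 : ℝ) ≤ n / ε := by
    rw [le_div_iff₀ hε]
    linarith
  have := Real.log_le_log (by norm_num) h1
  linarith [Real.log_two_gt_d9]

theorem exists_isMixingTime_le (hn : 2 ≤ n) (hT : IsLeagueTree n T) (hp : HasLeagueStructure p T)
    (hε : 0 < ε) (hε1 : ε ≤ 1) :
    ∃ τ : ℕ, IsMixingTime (treeChain T p) (permDist p) ε τ ∧
      (τ : ℝ) ≤ 3 * (n : ℝ) ^ 5 * Real.log (n / ε) := by
  have hn' : (2 : ℝ) ≤ n := by exact_mod_cast hn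
  -- Without bias κ = 1/2, and P-1 ≤ (1-ρ)P means ρP ≤ 1, where P ≤ n²/4.
  obtain ⟨τ, hτ, h⟩ := exists_isMixingTime (x := 0) (ρ := 4 / (n : ℝ) ^ 2) hn hT hp le_rfl
    zero_le_one (fun a b _ => by nlinarith [sq_nonneg (2 * p a b - 1)]) (by positivity)
    (by rw [div_le_one (by positivity)]; nlinarith) (fun P _ hP => by
      have : 4 / (n : ℝ) ^ 2 * P ≤ 1 := by
        rw [div_mul_eq_mul_div, div_le_one (by positivity)]
        exact hP
      linarith) hε hε1
  refine ⟨τ, hτ, h.trans ?_⟩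
  have hL := half_le_log hn hε hε1
  have e : 3 * (n : ℝ) ^ 3 / (4 / (n : ℝ) ^ 2) = 3 / 4 * (n : ℝ) ^ 5 := by
    field_simp
  rw [e]
  have h5 : (2 : ℝ) ^ 5 ≤ (n : ℝ) ^ 5 := by gcongr
  nlinarith

theorem exists_isMixingTime_le_of_le {q : ℝ} (hq0 : 1 / 2 < q) (hq1 : q ≤ 1) (hn : 2 ≤ n)
    (hT : IsLeagueTree n T) (hp : HasLeagueStructure p T)
    (hq : ∀ a b : Fin n, a < b → q ≤ p a b) (hε : 0 < ε) (hε1 : ε ≤ 1) :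
    ∃ τ : ℕ, IsMixingTime (treeChain T p) (permDist p) ε τ ∧
      (τ : ℝ) ≤ (18 / (2 * q - 1) ^ 2 + 2) * (n : ℝ) ^ 3 * Real.log (n / ε) := by
  have hn' : (2 : ℝ) ≤ n := by exact_mod_cast hn
  set x := (2 * q - 1) ^ 2 with hx
  have hx0 : 0 < x := by
    have : 0 < 2 * q - 1 := by linarith
    positivity
  have hx1 : x ≤ 1 := by rw [hx]; nlinarith
  -- Here 1-x = 4q(1-q), and ρ = x/3 works because (1-x/3)(2+x) = 2 + x(1-x)/3 ≥ 2.
  obtain ⟨τ, hτ, h⟩ := exists_isMixingTime (x := x) (ρ := x / 3) hn hT hp hx0.le hx1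
    (fun a b hab => by nlinarith [hq a b hab]) (by positivity) (by linarith)
    (fun P hP _ => by
      rw [← one_div, div_mul_eq_mul_div, div_le_iff₀ (by linarith)]
      nlinarith [mul_nonneg hP hx0.le, mul_nonneg (mul_nonneg hP hx0.le) (sub_nonneg.2 hx1)])
    hε hε1
  refine ⟨τ, hτ, h.trans ?_⟩
  have hL := half_le_log hn hε hε1
  have e : 3 * (n : ℝ) ^ 3 / (x / 3) = 9 / x * (n : ℝ) ^ 3 := by
    field_simp
    norm_num
  rw [e]
  have h3 : (2 : ℝ) ^ 3 ≤ (n : ℝ) ^ 3 := by gcongr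
  have h4 : 0 < 9 / x := by positivity
  have h5 : 18 / x = 2 * (9 / x) := by ring
  rw [h5]
  have h6 : 0 ≤ 9 / x * (n : ℝ) ^ 3 * Real.log (n / ε) := by positivity
  nlinarith

end MixingTime

end LeagueHierarchy

theorem mainTheorem4 :
    (∃ C : ℝ, 0 < C ∧
      ∀ (n : ℕ) (T : BinaryTree ℝ) (p : Fin n → Fin n → ℝ), 2 ≤ n →
        LeagueHierarchy.IsLeagueTree n T → LeagueHierarchy.HasLeagueStructure p T →
        ∀ ε : ℝ, 0 < ε → ε ≤ 1 →
          ∃ τ : ℕ,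
            LeagueHierarchy.IsMixingTime (LeagueHierarchy.treeChain T p)
              (LeagueHierarchy.permDist p) ε τ ∧
            (τ : ℝ) ≤ C * (n : ℝ) ^ 5 * Real.log ((n : ℝ) / ε)) ∧
    (∀ q₀ : ℝ, 1 / 2 < q₀ → ∃ C : ℝ, 0 < C ∧
      ∀ (n : ℕ) (T : BinaryTree ℝ) (p : Fin n → Fin n → ℝ), 2 ≤ n →
        LeagueHierarchy.IsLeagueTree n T → LeagueHierarchy.HasLeagueStructure p T →
        (∀ (v : List Bool) (q : ℝ), LeagueHierarchy.labelAt T v = some q → q₀ ≤ q) →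
        ∀ ε : ℝ, 0 < ε → ε ≤ 1 →
          ∃ τ : ℕ,
            LeagueHierarchy.IsMixingTime (LeagueHierarchy.treeChain T p)
              (LeagueHierarchy.permDist p) ε τ ∧
            (τ : ℝ) ≤ C * (n : ℝ) ^ 3 * Real.log (n : ℝ) * Real.log ((n : ℝ) / ε)) := by
  constructor
  · exact ⟨3, by norm_num, fun n T p hn hT hp ε hε hε1 =>
      LeagueHierarchy.exists_isMixingTime_le hn hT hp hε hε1⟩
  · intro q₀ hq₀
    -- Truncation at 1 treats `q₀ > 1` uniformly and keeps the bias parameter at most 1.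
    have hq : 1 / 2 < min q₀ 1 := lt_min hq₀ (by norm_num)
    have hpos : 0 < 2 * min q₀ 1 - 1 := by linarith
    refine ⟨2 * (18 / (2 * min q₀ 1 - 1) ^ 2 + 2), by positivity,
      fun n T p hn hT hp hlabel ε hε hε1 => ?_⟩
    obtain ⟨τ, hτ, h⟩ := LeagueHierarchy.exists_isMixingTime_le_of_le hq (min_le_right _ _) hn hT
      hp (fun a b hab => (min_le_left _ _).trans (hlabel _ _ (hp a b hab).1)) hε hε1
    refine ⟨τ, hτ, h.trans ?_⟩
    have hL := LeagueHierarchy.half_le_log hn hε hε1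
    -- The bound obtained has no factor log n; since 2 log n ≥ 1, that factor can be inserted at the
    -- cost of doubling the constant.
    have hlog : 1 / 2 ≤ Real.log n := by
      simpa using LeagueHierarchy.half_le_log hn one_pos le_rfl
    have h1 : 0 ≤ (18 / (2 * min q₀ 1 - 1) ^ 2 + 2) * (n : ℝ) ^ 3 * Real.log (n / ε) := by
      positivity
    nlinarith
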